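/- **Setting.** A cell-free massive MIMO-NOMA downlink has $M$ access points (APs) with $K$ antennas each and $L$ clusters of users, cluster $l$ having the ordered users $1,\dots,N_l$. The pilot length is $\tau_p=L<K$, and $\tau_p<\tau_c$. Let $\beta_{m,u}>0$ be the large-scale fading coefficients, $p_u>0$ the pilot powers, $\zeta_u\in[0,1]$ the SIC coefficients and $P_m>0$ the power budgets. For a user $u=n_l$ put $\gamma_{m,u}=\tau_p p_u\beta_{m,u}^2/(\tau_p\sum_{n'}p_{n'_l}\beta_{m,n'_l}+1)$ (sum over the cluster of $u$), and for a user $w$ put $\eta^{u}_{w}=\zeta_u$ if $w$ is a later user of the cluster of $u$, and $\eta^u_w=1$ otherwise. Below $n'\le n$ and $n''$ denote users of one cluster. The variables are amplitudes $\hat\rho^m_u\ge0$ (with powers $\rho^m_u=(\hat\rho^m_u)^2$), $r_u$, $\varphi_u$, $\bar\varphi_u$, $\varpi^n_{n'}$ and $\theta^n_{n'}$ (for $n'\le n$), and $\tau^{n'}_{n''}$. Put $$I^n_{n'}(\hat\rho,\tau)=\sum_{n''\ne n}\eta^n_{n''}(K-\tau_p)(\tau^{n'}_{n''})^2+\sum_{w}\sum_m\eta^n_w(\hat\rho^m_w)^2(\beta_{m,n'}-\gamma_{m,n'}),$$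 where $w$ runs over all users of all clusters. *Nonconvex problem* (NC): maximize $(1-\tau_p/\tau_c)\sum_u r_u$ subject to 1. $\sum_m\hat\rho^m_n\sqrt{\gamma_{m,n'}}\ge\varpi^n_{n'}$ and $I^n_{n'}(\hat\rho,\tau)\le\theta^n_{n'}$ for $n'\le n$; 2. $\sum_m\hat\rho^m_{n''}\sqrt{\gamma_{m,n'}}\le\tau^{n'}_{n''}$ for $n'\le n$, $n''\ne n$; 3. $\sum_u(\hat\rho^m_u)^2\le P_m$ for all $m$; $\hat\rho^m_n\le\hat\rho^m_{n+1}$ for all $m$ and consecutive users $n,n+1$ of a cluster; $\hat\rho\ge0$; 4. $(K-\tau_p)(\varpi^n_{n'})^2/(\theta^n_{n'}+1)\ge\varphi_n$ for $n'\le n$; 5. $\ln(1+\varphi_u)\ge r_u\ln2$ for all $u$. A *feasible point* is a point that satisfies these constraints and has $\varphi>0$ and $\varpi>0$. *Conic quadratic program* at $z=(\varphi^{(\kappa)},\varpi^{(\kappa)},\theta^{(\kappa)})$: the same objective, constraints 1–3, $\varphi>0$, and, in place of 4 and 5, $$(K-\tau_p)\Bigl(\tfrac{2\varpi^{n,(\kappa)}_{n'}}{\theta^{n,(\kappa)}_{n'}+1}\varpi^n_{n'}-\tfrac{(\varpi^{n,(\kappa)}_{n'})^2}{(\theta^{n,(\kappa)}_{n'}+1)^2}(\theta^n_{n'}+1)\Bigr)\ge\varphi_n\quad(n'\le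 n),$$ $$\ln(1+\varphi_u^{(\kappa)})+\tfrac{\varphi^{(\kappa)}_u}{\varphi^{(\kappa)}_u+1}-\tfrac{(\varphi^{(\kappa)}_u)^2}{\varphi^{(\kappa)}_u+1}\bar\varphi_u\ge r_u\ln2,\qquad \tfrac14(\varphi_u+\bar\varphi_u)^2\ge\tfrac14(\varphi_u-\bar\varphi_u)^2+1\quad\text{for all }u.$$ *Algorithm*: start from the part $(\varphi^{(0)},\varpi^{(0)},\theta^{(0)})$ of a feasible point. At iteration $\kappa+1$ take any optimal solution of the conic quadratic program at $(\varphi^{(\kappa)},\varpi^{(\kappa)},\theta^{(\kappa)})$, and let $(\varphi^{(\kappa+1)},\varpi^{(\kappa+1)},\theta^{(\kappa+1)})$ be its part and $\hat\rho^{(\kappa+1)},r^{(\kappa+1)}$ its amplitudes and rates. Stop when $\bigl(\sum_u r^{(\kappa)}_u-\sum_u r^{(\kappa-1)}_u\bigr)/\sum_u r^{(\kappa-1)}_u<\epsilon$. **Proposition 1.** From every feasible point the algorithm can be run: at a feasible point the conic quadratic program has an optimal solution, and every optimal solution is again a feasible point. For every run (without the stopping rule) the following hold. (a) Every iterate is a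 feasible point of (NC). Its powers $\rho=\hat\rho^2$ satisfy $\rho\ge 0$, $\sum_u\rho^m_u\le P_m$ and $\rho^m_n\le\rho^m_{n+1}$, and together with $r$ and $\varphi$ they satisfy $\ln(1+\varphi_n)\ge r_n\ln2$ and, for $n'\le n$, $$\frac{(K-\tau_p)\bigl(\sum_m\sqrt{\rho^m_n\gamma_{m,n'}}\bigr)^2}{\sum_{n''\ne n}\eta^n_{n''}(K-\tau_p)\bigl(\sum_m\sqrt{\rho^m_{n''}\gamma_{m,n'}}\bigr)^2+\sum_w\sum_m\eta^n_w\rho^m_w(\beta_{m,n'}-\gamma_{m,n'})+1}\ge\varphi_n .$$ (b) Each solution improves on the previous iterate: $(1-\tau_p/\tau_c)\sum_u\log_2(1+\varphi_u^{(\kappa)})\le(1-\tau_p/\tau_c)\sum_u r_u^{(\kappa+1)}$. The sequence $(1-\tau_p/\tau_c)\sum_u r^{(\kappa)}_u$ is monotonically increasing (nondecreasing) and convergent. (c) For every $\epsilon>0$ the stopping rule is met after finitely many iterations, and at all later ones. (d) Each solution satisfies the Karush-Kuhn-Tucker (KKT) conditions of the conic quadratic program that it solves. (e) Every accumulation point $(\varphi^*,\varpi^*,\theta^*)$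 of the sequence $(\varphi^{(\kappa)},\varpi^{(\kappa)},\theta^{(\kappa)})$ is the corresponding part of a KKT point of (NC), provided that for every user $n$ either $\varphi^*_n>0$ or $\varpi^{*n}_{n'}=0$ for some $n'\le n$. If the sequence converges, its limit is the corresponding part of a KKT point of (NC), without this proviso. For every $c>0$, if $\min_u\varphi_u^{(\kappa)}\ge c$ for infinitely many $\kappa$, then there is an accumulation point with $\varphi^*_u\ge c$ for all $u$. -/

import Mathlib

open Filter Topology

noncomputable section

/-! ### Smooth constrained maximization -/

/-- A problem `maximize obj x` subject to `0 ≤ con i x` for all `i`, where `x` ranges over `dom`,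
the set on which the functions of the problem are considered. -/
structure NLP (E ι : Type) where
  dom : Set E
  obj : E → ℝ
  con : ι → E → ℝ

namespace NLP

variable {E ι : Type}

def Feasible (P : NLP E ι) (x : E) : Prop :=
  x ∈ P.dom ∧ ∀ i, 0 ≤ P.con i x

/-- `x` is a (globally) optimal solution. -/
def IsOptimal (P : NLP E ι) (x : E) : Prop :=
  P.Feasible x ∧ ∀ y, P.Feasible y → P.obj y ≤ P.obj x

/-- The Karush-Kuhn-Tucker conditions at `x`: primal feasibility, and multipliers that are
nonnegative, satisfy complementary slackness, and make the gradient of the Lagrangian vanish. -/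
def IsKKT [NormedAddCommGroup E] [NormedSpace ℝ E] [Fintype ι] (P : NLP E ι) (x : E) : Prop :=
  P.Feasible x ∧
    ∃ (mult : ι → ℝ) (f' : E →L[ℝ] ℝ) (g' : ι → E →L[ℝ] ℝ),
      (∀ i, 0 ≤ mult i) ∧ (∀ i, mult i * P.con i x = 0) ∧
      HasFDerivAt P.obj f' x ∧ (∀ i, HasFDerivAt (P.con i) (g' i) x) ∧
      f' + ∑ i, mult i • g' i = 0

end NLP

/-! ### The network -/

/-- A cell-free massive MIMO-NOMA downlink with full-pilot zero-forcing: `M` access points (APs)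
with `K` antennas each, `L` clusters of users, cluster `l` having `N l` users, pilot length `L`
(one pilot per cluster), coherence interval `τc`, large-scale fading coefficients `β`, normalized
pilot powers `pilot`, SIC coefficients `ζ`, and normalized power budgets `Pmax` of the APs. -/
structure Network where
  L : ℕ
  M : ℕ
  K : ℕ
  τc : ℕ
  N : Fin L → ℕ
  β : Fin M → (Σ l, Fin (N l)) → ℝ
  pilot : (Σ l, Fin (N l)) → ℝ
  ζ : (Σ l, Fin (N l)) → ℝ
  Pmax : Fin M → ℝ
  L_lt_K : L < K
  L_lt_τc : L < τc
  β_pos : ∀ m u, 0 < β m u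
  pilot_pos : ∀ u, 0 < pilot u
  ζ_nonneg : ∀ u, 0 ≤ ζ u
  ζ_le_one : ∀ u, ζ u ≤ 1
  Pmax_pos : ∀ m, 0 < Pmax m

namespace Network

/-- The users: `⟨l, n⟩` is user `n` of cluster `l`. -/
abbrev UE (S : Network) : Type := Σ l, Fin (S.N l)

/-- The pairs `(n, n')` of users of one cluster with `n' ≤ n`: user `n'` decodes the signal of
user `n`. The variables `ϖ^n_{n'}` and `θ^n_{n'}` are indexed by them. -/
abbrev DecPair (S : Network) : Type :=
  Σ l, {p : Fin (S.N l) × Fin (S.N l) // p.2 ≤ p.1}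

/-- All pairs `(n', n'')` of users of one cluster; the variable `τ^{n'}_{n''}` is indexed by them
(`n'` receives, `n''` interferes). -/
abbrev CoPair (S : Network) : Type := Σ l, Fin (S.N l) × Fin (S.N l)

/-- The triples `(n, n', n'')` of users of one cluster with `n' ≤ n` and `n'' ≠ n`. -/
abbrev Triple (S : Network) : Type :=
  Σ l, {p : Fin (S.N l) × Fin (S.N l) × Fin (S.N l) // p.2.1 ≤ p.1 ∧ p.2.2 ≠ p.1}

/-- The pairs `(n, n + 1)` of consecutive users of one cluster. -/
abbrev SuccPair (S : Network) : Type :=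
  Σ l, {p : Fin (S.N l) × Fin (S.N l) // (p.2 : ℕ) = (p.1 : ℕ) + 1}

/-- The user `n` whose signal is decoded. -/
def DecPair.sig {S : Network} (d : S.DecPair) : S.UE := ⟨d.1, d.2.1.1⟩

/-- The user `n'` that decodes. -/
def DecPair.rx {S : Network} (d : S.DecPair) : S.UE := ⟨d.1, d.2.1.2⟩

variable (S : Network)

/-- The pre-log factor `1 - τp / τc`, with `τp = L`. -/
def prelog : ℝ := 1 - (S.L : ℝ) / (S.τc : ℝ)

/-- `K - τp`. -/
def dof : ℝ := (S.K : ℝ) - (S.L : ℝ)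

/-- The mean square `γ` of the channel estimate. -/
def γ (m : Fin S.M) (u : S.UE) : ℝ :=
  (S.L : ℝ) * S.pilot u * S.β m u ^ 2 /
    ((S.L : ℝ) * ∑ n' : Fin (S.N u.1), S.pilot ⟨u.1, n'⟩ * S.β m ⟨u.1, n'⟩ + 1)

/-- The coefficient `η` of the signal of user `w` when the signal of user `u` is decoded: `ζ u` if
`w` is in the cluster of `u` and comes after `u`, and `1` otherwise. -/
def η (u w : S.UE) : ℝ :=
  if w.1 = u.1 ∧ (u.2 : ℕ) < (w.2 : ℕ) then S.ζ u else 1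

/-! ### The sum spectral efficiency problem in the transmit powers -/

/-- The interference `I^n_{n'}(ρ)`. -/
def interference (ρ : Fin S.M → S.UE → ℝ) (d : S.DecPair) : ℝ :=
  (∑ n'' ∈ Finset.univ.erase d.2.1.1, S.η d.sig ⟨d.1, n''⟩ * S.dof *
      (∑ m, √(ρ m ⟨d.1, n''⟩ * S.γ m d.rx)) ^ 2) +
    ∑ w : S.UE, ∑ m, S.η d.sig w * ρ m w * (S.β m d.rx - S.γ m d.rx)

/-- `SINR^n_{n'}`: the signal-to-interference-plus-noise ratio when user `n'` decodes the signal
of user `n`. -/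
def sinr (ρ : Fin S.M → S.UE → ℝ) (d : S.DecPair) : ℝ :=
  S.dof * (∑ m, √(ρ m d.sig * S.γ m d.rx)) ^ 2 / (S.interference ρ d + 1)

/-- Feasibility of powers `ρ`, rates `r` and SINR levels `φ` for the problem of maximizing
`(1 - τp / τc) ∑ r`: power budgets, SIC ordering of the powers, `log (1 + φ) ≥ r log 2`, and
`SINR^n_{n'} ≥ φ_n` for all `n' ≤ n`. -/
structure SumSEFeasible (ρ : Fin S.M → S.UE → ℝ) (r φ : S.UE → ℝ) : Prop where
  nonneg : ∀ m u, 0 ≤ ρ m u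
  budget : ∀ m, ∑ u, ρ m u ≤ S.Pmax m
  order : ∀ m (p : S.SuccPair), ρ m ⟨p.1, p.2.1.1⟩ ≤ ρ m ⟨p.1, p.2.1.2⟩
  phi_dom : ∀ u, -1 < φ u
  rate : ∀ u, r u * Real.log 2 ≤ Real.log (1 + φ u)
  sinr_ge : ∀ d : S.DecPair, φ d.sig ≤ S.sinr ρ d

/-! ### The optimization variables after the change `ρ = ρ̂ ^ 2` -/

/-- The scalar variables: amplitudes `ρ̂`, rates `r`, SINR levels `φ`, their inverses `φ̄`, and the
slack variables `ϖ`, `τ`, `θ`. -/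
inductive Coord (S : Network) : Type
  | amp (m : Fin S.M) (u : S.UE)
  | rate (u : S.UE)
  | phi (u : S.UE)
  | phibar (u : S.UE)
  | varpi (d : S.DecPair)
  | tau (c : S.CoPair)
  | theta (d : S.DecPair)
  deriving Fintype

/-- A value for each of the variables. -/
abbrev Point (S : Network) : Type := Coord S → ℝ

/-- `(φ, ϖ, θ)`, the part of a point that the algorithm passes on to the next iteration. -/
abbrev Iterate (S : Network) : Type := (S.UE → ℝ) × (S.DecPair → ℝ) × (S.DecPair → ℝ)

def iterate (x : S.Point) : S.Iterate :=
  (fun u => x (.phi u), fun d => x (.varpi d), fun d => x (.theta d))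

/-- The transmit powers `ρ = ρ̂ ^ 2`. -/
def powers (x : S.Point) : Fin S.M → S.UE → ℝ := fun m u => x (.amp m u) ^ 2

/-- The objective `(1 - τp / τc) ∑ r`. -/
def objective (x : S.Point) : ℝ := S.prelog * ∑ u : S.UE, x (.rate u)

/-- The amplitude `∑ₘ ρ̂ᵐ_w √γ_{m,v}` at which `v` receives the signal of `w`. -/
def received (x : S.Point) (w v : S.UE) : ℝ := ∑ m, x (.amp m w) * √(S.γ m v)

/-- The interference `I^n_{n'}(ρ̂, τ)`, a quadratic function. -/
def slackInterference (x : S.Point) (d : S.DecPair) : ℝ :=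
  (∑ n'' ∈ Finset.univ.erase d.2.1.1, S.η d.sig ⟨d.1, n''⟩ * S.dof *
      x (.tau ⟨d.1, d.2.1.2, n''⟩) ^ 2) +
    ∑ w : S.UE, ∑ m, S.η d.sig w * x (.amp m w) ^ 2 * (S.β m d.rx - S.γ m d.rx)

/-- The indices of the constraints that the nonconvex problem and its convex approximations have
in common or that correspond to each other in them. -/
inductive Con (S : Network) : Type
  | signal (d : S.DecPair)
  | cross (t : S.Triple)
  | interf (d : S.DecPair)
  | level (d : S.DecPair)
  | budget (m : Fin S.M)
  | order (m : Fin S.M) (p : S.SuccPair)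
  | nonneg (m : Fin S.M) (u : S.UE)
  | rate (u : S.UE)
  deriving Fintype

/-- The constraints, in the form `0 ≤ _`, with a function `q` for the lower bound on the SINR and a
function `f` for the lower bound on `log (1 + φ)`. The amplitudes are `ρ̂ = √ρ`, hence
nonnegative. -/
def constraint (q : S.DecPair → S.Point → ℝ) (f : S.UE → S.Point → ℝ) :
    Con S → S.Point → ℝ
  | .signal d, x => S.received x d.sig d.rx - x (.varpi d)
  | .cross t, x =>
      x (.tau ⟨t.1, t.2.1.2.1, t.2.1.2.2⟩) - S.received x ⟨t.1, t.2.1.2.2⟩ ⟨t.1, t.2.1.2.1⟩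
  | .interf d, x => x (.theta d) - S.slackInterference x d
  | .level d, x => q d x - x (.phi d.sig)
  | .budget m, x => S.Pmax m - ∑ u : S.UE, x (.amp m u) ^ 2
  | .order m p, x => x (.amp m ⟨p.1, p.2.1.2⟩) - x (.amp m ⟨p.1, p.2.1.1⟩)
  | .nonneg m u, x => x (.amp m u)
  | .rate u, x => f u x - x (.rate u) * Real.log 2

/-- The nonconvex problem in the slack variables: the SINR constraint is
`(K - τp) ϖ² / (θ + 1) ≥ φ` and the rate constraint is `log (1 + φ) ≥ r log 2`. The coordinate
`φ̄` is not used. -/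
def slackProblem : NLP S.Point (Con S) where
  dom := {x | (∀ u, -1 < x (.phi u)) ∧ ∀ d, -1 < x (.theta d)}
  obj := S.objective
  con := S.constraint
    (fun d x => S.dof * (x (.varpi d) ^ 2 / (x (.theta d) + 1)))
    (fun u x => Real.log (1 + x (.phi u)))

/-- The conic quadratic program built at `z = (φ, ϖ, θ)`: `ϖ² / (θ + 1)` is replaced by its
linearization and `log (1 + φ)` by a lower bound that is affine in `φ̄`. The second-order cone
constraint, with index `Sum.inr u`, says that `φ φ̄ ≥ 1` (for `φ > 0`). -/
def cqp (z : S.Iterate) : NLP S.Point (Con S ⊕ S.UE) where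
  dom := {x | ∀ u, 0 < x (.phi u)}
  obj := S.objective
  con := Sum.elim
    (S.constraint
      (fun d x => S.dof *
        (2 * z.2.1 d / (z.2.2 d + 1) * x (.varpi d) -
          z.2.1 d ^ 2 / (z.2.2 d + 1) ^ 2 * (x (.theta d) + 1)))
      (fun u x => Real.log (1 + z.1 u) + z.1 u / (z.1 u + 1) -
        z.1 u ^ 2 / (z.1 u + 1) * x (.phibar u)))
    (fun u x => 0.25 * (x (.phi u) + x (.phibar u)) ^ 2 -
      (0.25 * (x (.phi u) - x (.phibar u)) ^ 2 + 1))

/-- Feasible points: feasible for the nonconvex problem, with positive `φ` (as the lower bound on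
`log (1 + φ)` requires) and positive `ϖ` (a lower bound on an amplitude). -/
structure IsFeasiblePoint (x : S.Point) : Prop where
  feasible : S.slackProblem.Feasible x
  phi_pos : ∀ u, 0 < x (.phi u)
  varpi_pos : ∀ d, 0 < x (.varpi d)

/-- The sequences that the algorithm can produce without its stopping rule: `x 0` is the initial
point (only its part `(φ, ϖ, θ)` matters), and `x (κ + 1)` is an optimal solution, whichever the
solver returns, of the conic quadratic program built at the iterate `κ`. -/
def IsRun (x : ℕ → S.Point) : Prop :=
  ∀ κ, (S.cqp (S.iterate (x κ))).IsOptimal (x (κ + 1))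

/-- The stopping rule: the relative increase of `∑ r` from `y` to `x` is less than `ε`. -/
def Stops (ε : ℝ) (y x : S.Point) : Prop :=
  (∑ u : S.UE, x (.rate u) - ∑ u : S.UE, y (.rate u)) / ∑ u : S.UE, y (.rate u) < ε

/-- `z = (φ, ϖ, θ)` is the corresponding part of a KKT point of the nonconvex problem. -/
def IsKKTIterate (z : S.Iterate) : Prop :=
  ∃ y : S.Point, S.iterate y = z ∧ S.slackProblem.IsKKT y

end Network

end

/-! The algorithm is a minorize-maximize scheme. The function `ϖ² / (θ + 1)` is jointly convex, so
its linearization lies below it, and `log (1 + φ)` has a minorant affine in `1 / φ`; both minorants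
touch to first order at the current iterate. Minorization makes every point feasible for the program
feasible for the nonconvex problem (`IsFeasiblePoint.of_cqp`). Tangency makes the current iterate,
with its rates raised to `logb 2 (1 + φ)`, a competitor in its own program
(`IsFeasiblePoint.cqp_feasible_tight`). Hence the objective values increase, and the power budgets
bound them.

Multipliers come from Gordan's alternative, which gives Fritz John conditions, together with the
Mangasarian-Fromovitz condition, which makes the multiplier of the objective positive. That
condition holds everywhere because the constraints are triangular: once the amplitudes move towards
a strictly feasible profile, the variables `τ`, `θ`, `ϖ`, `φ`, `φ̄`, `r` can be moved in turn, each
fast enough to satisfy the next constraint strictly (`exists_constraint_direction`).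

For accumulation points the argument compares values, so the solutions of successive programs need
not converge together. Suppose that at a limit `y` some direction increased the rates of the users
with `φ > 0` and all active constraints that concern them. A short step would strictly satisfy the
limiting constraints, hence satisfy those of some program of the run; the users with `φ = 0` simply
keep the levels of the iterate there. Its value would exceed the value at `y`, which bounds all
values of the run (`IsLimit.not_exists_ascent`). So multipliers exist for the users with `φ > 0`.
For a user with `φ = 0` and some `ϖ = 0`, the gradients of its rate and level constraints add up to
a multiple of `dr`, which supplies the missing multipliers. If the whole sequence converges, the
remaining case (`φ = 0` and all `ϖ > 0`) contradicts the tightness of some level constraint at every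
solution (`exists_level_le_of_isOptimal`). -/

noncomputable section

/-! ### Theorems of the alternative and Lagrange multipliers -/

/-- Gordan's theorem of the alternative for finitely many linear functionals. -/
theorem exists_nonneg_combination_eq_zero {E κ : Type} [AddCommGroup E] [Module ℝ E] [Fintype κ]
    (g : κ → E →ₗ[ℝ] ℝ) (h : ¬ ∃ d, ∀ j, 0 < g j d) :
    ∃ c : κ → ℝ, (∀ j, 0 ≤ c j) ∧ c ≠ 0 ∧ ∀ d, ∑ j, c j * g j d = 0 := by
  classical
  let T : E →ₗ[ℝ] (κ → ℝ) := LinearMap.pi g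
  have hconv : Convex ℝ (Set.pi Set.univ fun _ : κ => Set.Ioi (0 : ℝ)) :=
    convex_pi fun _ _ => convex_Ioi 0
  have hopen : IsOpen (Set.pi Set.univ fun _ : κ => Set.Ioi (0 : ℝ)) :=
    isOpen_set_pi Set.finite_univ fun _ _ => isOpen_Ioi
  have hdisj : Disjoint (Set.pi Set.univ fun _ : κ => Set.Ioi (0 : ℝ))
      (LinearMap.range T : Set (κ → ℝ)) := by
    rw [Set.disjoint_left]
    rintro _ hv ⟨d, rfl⟩
    exact h ⟨d, fun j => hv j (Set.mem_univ j)⟩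
  obtain ⟨F, b, hF, hb⟩ := geometric_hahn_banach_open hconv hopen
    (LinearMap.range T).convex hdisj
  have hb0 : b ≤ 0 := by simpa using hb 0 (Submodule.zero_mem _)
  have hneg : ∀ v : κ → ℝ, (∀ j, 0 < v j) → F v < 0 := fun v hv =>
    (hF v fun j _ => hv j).trans_le hb0
  have hzero : ∀ d, F (T d) = 0 := by
    intro d
    by_contra hne
    -- The scaling gives `F` the value `b - 1` at a point of the range, below the separating level
    -- `b`.
    have := hb (T (((b - 1) / F (T d)) • d)) ⟨_, rfl⟩
    rw [map_smul, map_smul, smul_eq_mul, div_mul_cancel₀ _ hne] at this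
    linarith
  have hsum : ∀ v : κ → ℝ, F v = ∑ j, v j * F (Pi.single j 1) := by
    intro v
    conv_lhs => rw [pi_eq_sum_univ' v]
    simp [map_sum]
  have hcoef : ∀ j, F (Pi.single j 1) ≤ 0 := by
    intro j
    -- A unit vector is only on the boundary of the open orthant; adding `ε • 1` moves it inside.
    have hlim : Tendsto (fun ε : ℝ => F (Pi.single j 1 + ε • 1)) (𝓝[>] 0)
        (𝓝 (F (Pi.single j 1 + (0 : ℝ) • 1))) := by
      apply Tendsto.mono_left _ nhdsWithin_le_nhds
      exact (by fun_prop : Continuous fun ε : ℝ => F (Pi.single j 1 + ε • 1)).tendsto 0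
    rw [zero_smul, add_zero] at hlim
    refine le_of_tendsto hlim ?_
    filter_upwards [self_mem_nhdsWithin] with ε hε
    refine (hneg _ fun i => ?_).le
    have hε' : (0 : ℝ) < ε := hε
    by_cases hij : i = j
    · subst hij; simp; linarith
    · simp [Pi.single_eq_of_ne hij, hε']
  refine ⟨fun j => -F (Pi.single j 1), fun j => by have := hcoef j; linarith, ?_, ?_⟩
  · intro hc
    have h1 := hneg 1 fun _ => one_pos
    rw [hsum] at h1
    have : ∀ j, F (Pi.single j 1) = 0 := fun j => by simpa using congrFun hc j
    simp [this] at h1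
  · intro d
    have := hzero d
    rw [hsum] at this
    simp only [neg_mul, Finset.sum_neg_distrib, neg_eq_zero]
    rw [← this]
    exact Finset.sum_congr rfl fun j _ => mul_comm _ _

/-- Multipliers on the index set `J` exist if no direction makes `f` and all `g i`, `i ∈ J`,
positive, while some direction makes all `g i`, `i ∈ J`, positive. -/
theorem exists_multipliers {E ι : Type} [NormedAddCommGroup E] [NormedSpace ℝ E] [Fintype ι]
    (J : ι → Prop) (f : E →L[ℝ] ℝ) (g : ι → E →L[ℝ] ℝ)
    (hno : ¬ ∃ d, 0 < f d ∧ ∀ i, J i → 0 < g i d) (hcq : ∃ d, ∀ i, J i → 0 < g i d) :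
    ∃ mult : ι → ℝ, (∀ i, 0 ≤ mult i) ∧ (∀ i, ¬ J i → mult i = 0) ∧
      f + ∑ i, mult i • g i = 0 := by
  classical
  obtain ⟨c, hc0, hcne, hc⟩ := exists_nonneg_combination_eq_zero
    (κ := Option {i // J i})
    (fun o => o.elim (f : E →ₗ[ℝ] ℝ) fun i => (g i : E →ₗ[ℝ] ℝ)) (by
      rintro ⟨d, hd⟩
      exact hno ⟨d, hd none, fun i hi => hd (some ⟨i, hi⟩)⟩)
  simp only [Fintype.sum_option, Option.elim] at hc
  -- If the coefficient of `f` were `0`, evaluating at the direction of `hcq` would make a sum of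
  -- nonnegative terms vanish and force every coefficient to be `0`.
  have hpos : 0 < c none := by
    refine lt_of_le_of_ne (hc0 none) fun h0 => hcne ?_
    obtain ⟨d, hd⟩ := hcq
    have h1 := hc d
    rw [← h0, zero_mul, zero_add] at h1
    have h2 := (Finset.sum_eq_zero_iff_of_nonneg (fun i _ =>
      mul_nonneg (hc0 (some i)) (hd i.1 i.2).le)).1 h1
    funext o
    rcases o with _ | i
    · exact h0.symm
    · have := h2 i (Finset.mem_univ i)
      rcases mul_eq_zero.1 this with h | h
      · exact h
      · exact absurd h (hd i.1 i.2).ne'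
  refine ⟨fun i => if hi : J i then c (some ⟨i, hi⟩) / c none else 0, fun i => ?_,
    fun i hi => dif_neg hi, ?_⟩
  · dsimp only
    split_ifs with hi
    · exact div_nonneg (hc0 _) hpos.le
    · exact le_rfl
  · ext d
    have h1 := hc d
    have h2 : ∑ i, (if hi : J i then c (some ⟨i, hi⟩) / c none else 0) * g i d =
        ∑ i : {i // J i}, c (some i) / c none * g i d := by
      rw [← Fintype.sum_subtype_add_sum_subtype J]
      have hJ : ∀ i : {i // ¬ J i},
          (if hi : J i then c (some ⟨i, hi⟩) / c none else 0) * g i d = 0 := fun i => by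
        rw [dif_neg i.2, zero_mul]
      rw [Finset.sum_eq_zero fun i _ => hJ i, add_zero]
      exact Finset.sum_congr rfl fun i _ => by rw [dif_pos i.2]
    simp only [add_apply, sum_apply, smul_apply, smul_eq_mul, zero_apply]
    rw [h2]
    have h3 : ∑ i : {i // J i}, c (some i) / c none * g i d =
        (∑ i : {i // J i}, c (some i) * g i d) / c none := by
      rw [Finset.sum_div]
      exact Finset.sum_congr rfl fun i _ => by ring
    simp only [ContinuousLinearMap.coe_coe] at h1
    rw [h3, eq_neg_of_add_eq_zero_right h1]
    field_simp
    ring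

/-- A function that is nonnegative at `x`, and increasing along `d` if it vanishes at `x`, is
positive at the points `x + t d` for small `t > 0`. -/
theorem eventually_pos_of_hasFDerivAt {E : Type} [NormedAddCommGroup E] [NormedSpace ℝ E]
    {g : E → ℝ} {g' : E →L[ℝ] ℝ} {x d : E} (hg : HasFDerivAt g g' x) (h0 : 0 ≤ g x)
    (hd : g x = 0 → 0 < g' d) : ∀ᶠ t : ℝ in 𝓝[>] 0, 0 < g (x + t • d) := by
  have hline : HasDerivAt (fun t : ℝ => g (x + t • d)) (g' d) 0 := by
    have h1 : HasDerivAt (fun t : ℝ => x + t • d) d 0 := by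
      simpa using ((hasDerivAt_id (0 : ℝ)).smul_const d).const_add x
    have h2 : HasFDerivAt g g' (x + (0 : ℝ) • d) := by simpa using hg
    exact h2.comp_hasDerivAt (0 : ℝ) h1
  rcases h0.eq_or_lt with h | h
  · have hpos := hd h.symm
    have hs := hline.hasDerivWithinAt (s := Set.Ioi 0)
    rw [hasDerivWithinAt_iff_tendsto_slope' (by simp)] at hs
    filter_upwards [hs.eventually (lt_mem_nhds hpos), self_mem_nhdsWithin] with t ht ht0
    have ht0' : (0 : ℝ) < t := ht0
    rw [slope_def_field] at ht
    simp only [zero_smul, add_zero, ← h, sub_zero] at ht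
    exact (div_pos_iff_of_pos_right ht0').1 ht
  · have hc : Tendsto (fun t : ℝ => g (x + t • d)) (𝓝[>] 0) (𝓝 (g x)) := by
      have := hline.continuousAt.tendsto
      simp only [zero_smul, add_zero] at this
      exact this.mono_left nhdsWithin_le_nhds
    exact hc.eventually (lt_mem_nhds h)

namespace NLP

/-- An optimal solution in the interior of the domain at which the Mangasarian-Fromovitz
constraint qualification holds is a KKT point. -/
theorem IsOptimal.isKKT {E ι : Type} [NormedAddCommGroup E] [NormedSpace ℝ E] [Fintype ι]
    {P : NLP E ι} {x : E} (hx : P.IsOptimal x) (hdom : P.dom ∈ 𝓝 x)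
    {f' : E →L[ℝ] ℝ} {g' : ι → E →L[ℝ] ℝ} (hf : HasFDerivAt P.obj f' x)
    (hg : ∀ i, HasFDerivAt (P.con i) (g' i) x)
    (hcq : ∃ d, ∀ i, P.con i x = 0 → 0 < g' i d) : P.IsKKT x := by
  obtain ⟨mult, h0, hJ, hsum⟩ := exists_multipliers (fun i => P.con i x = 0) f' g' (by
    rintro ⟨d, hfd, hgd⟩
    have h1 : ∀ᶠ t : ℝ in 𝓝[>] 0, ∀ i, 0 < P.con i (x + t • d) :=
      eventually_all.2 fun i => eventually_pos_of_hasFDerivAt (hg i) (hx.1.2 i) (hgd i)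
    have h2 : ∀ᶠ t : ℝ in 𝓝[>] 0, 0 < P.obj (x + t • d) - P.obj x :=
      eventually_pos_of_hasFDerivAt (g := fun y => P.obj y - P.obj x)
        (hf.sub_const (P.obj x)) (by simp) (fun _ => hfd)
    have h3 : ∀ᶠ t : ℝ in 𝓝[>] 0, x + t • d ∈ P.dom := by
      have hc : Tendsto (fun t : ℝ => x + t • d) (𝓝[>] 0) (𝓝 x) := by
        have := (by fun_prop : Continuous fun t : ℝ => x + t • d).tendsto 0
        simp only [zero_smul, add_zero] at this
        exact this.mono_left nhdsWithin_le_nhds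
      exact hc.eventually hdom
    obtain ⟨t, ht1, ht2, ht3⟩ := (h1.and (h2.and h3)).exists
    have := hx.2 _ ⟨ht3, fun i => (ht1 i).le⟩
    linarith) hcq
  exact ⟨hx.1, mult, f', g', h0, fun i => by
    by_cases h : P.con i x = 0
    · rw [h, mul_zero]
    · rw [hJ i h, zero_mul], hf, hg, hsum⟩

end NLP

/-! ### Elementary bounds for channels, amplitudes and interference -/

namespace Network

variable (S : Network)

theorem dof_pos : 0 < S.dof := by
  have : (S.L : ℝ) < S.K := by exact_mod_cast S.L_lt_K
  unfold dof; linarith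

theorem prelog_pos : 0 < S.prelog := by
  have h : (S.L : ℝ) < S.τc := by exact_mod_cast S.L_lt_τc
  have h0 : (0 : ℝ) ≤ S.L := Nat.cast_nonneg _
  unfold prelog
  rw [sub_pos, div_lt_one (by linarith)]
  exact h

theorem cluster_sum_nonneg (m : Fin S.M) (l : Fin S.L) :
    0 ≤ ∑ n' : Fin (S.N l), S.pilot ⟨l, n'⟩ * S.β m ⟨l, n'⟩ :=
  Finset.sum_nonneg fun _ _ => (mul_pos (S.pilot_pos _) (S.β_pos _ _)).le

theorem γ_pos (m : Fin S.M) (u : S.UE) : 0 < S.γ m u := by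
  have hL : (0 : ℝ) < S.L := by exact_mod_cast (Nat.zero_le _).trans_lt u.1.isLt
  have := S.cluster_sum_nonneg m u.1
  have := S.pilot_pos u
  have := S.β_pos m u
  unfold γ
  positivity

/-- The own term of the user in the cluster sum already matches the numerator, and the noise term
`1` makes the inequality strict. This makes the interference, and with it every feasible `θ`,
nonnegative. -/
theorem γ_lt_β (m : Fin S.M) (u : S.UE) : S.γ m u < S.β m u := by
  have hL : (0 : ℝ) < S.L := by exact_mod_cast (Nat.zero_le _).trans_lt u.1.isLt
  have h0 := S.cluster_sum_nonneg m u.1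
  have hβ := S.β_pos m u
  have hle : S.pilot u * S.β m u ≤
      ∑ n' : Fin (S.N u.1), S.pilot ⟨u.1, n'⟩ * S.β m ⟨u.1, n'⟩ :=
    Finset.single_le_sum (f := fun n' : Fin (S.N u.1) => S.pilot ⟨u.1, n'⟩ * S.β m ⟨u.1, n'⟩)
      (fun _ _ => (mul_pos (S.pilot_pos _) (S.β_pos _ _)).le) (Finset.mem_univ u.2)
  unfold γ
  rw [div_lt_iff₀ (by positivity)]
  have := mul_le_mul_of_nonneg_left hle (mul_pos hL hβ).le
  nlinarith

theorem η_nonneg (u w : S.UE) : 0 ≤ S.η u w := by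
  unfold η
  split_ifs
  · exact S.ζ_nonneg u
  · exact zero_le_one

/-- The point with the given coordinates. -/
def ofParts (a : Fin S.M → S.UE → ℝ) (r p pb : S.UE → ℝ) (v : S.DecPair → ℝ) (t : S.CoPair → ℝ)
    (th : S.DecPair → ℝ) : S.Point
  | .amp m u => a m u
  | .rate u => r u
  | .phi u => p u
  | .phibar u => pb u
  | .varpi d => v d
  | .tau c => t c
  | .theta d => th d

/-- The value of `τ^{n'}_{n''}` at which the cross constraints are tight. -/
def crossReceived (x : S.Point) (c : S.CoPair) : ℝ := S.received x ⟨c.1, c.2.2⟩ ⟨c.1, c.2.1⟩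

/-- The interference as a function of the amplitudes alone. -/
def ampInterference (x : S.Point) (d : S.DecPair) : ℝ :=
  (∑ n'' ∈ Finset.univ.erase d.2.1.1, S.η d.sig ⟨d.1, n''⟩ * S.dof *
      S.crossReceived x ⟨d.1, d.2.1.2, n''⟩ ^ 2) +
    ∑ w : S.UE, ∑ m, S.η d.sig w * x (.amp m w) ^ 2 * (S.β m d.rx - S.γ m d.rx)

theorem received_congr {x y : S.Point} (h : ∀ m u, x (.amp m u) = y (.amp m u)) (w v : S.UE) :
    S.received x w v = S.received y w v :=
  Finset.sum_congr rfl fun m _ => by rw [h]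

theorem slackInterference_eq {x y : S.Point} (h : ∀ m u, x (.amp m u) = y (.amp m u))
    (ht : ∀ c, x (.tau c) = S.crossReceived y c) (d : S.DecPair) :
    S.slackInterference x d = S.ampInterference y d := by
  simp only [slackInterference, ampInterference, h, ht]

theorem received_nonneg {x : S.Point} (h : ∀ m u, 0 ≤ x (.amp m u)) (w v : S.UE) :
    0 ≤ S.received x w v :=
  Finset.sum_nonneg fun m _ => mul_nonneg (h m w) (Real.sqrt_nonneg _)

/-- The cross constraints bound nonnegative amplitudes by `τ`, so squaring preserves them. Only the
pairs with `n'' ≠ n` enter the sum, and these are the ones that have a cross constraint. -/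
theorem ampInterference_le {x : S.Point} (h : ∀ m u, 0 ≤ x (.amp m u))
    (ht : ∀ t : S.Triple, S.received x ⟨t.1, t.2.1.2.2⟩ ⟨t.1, t.2.1.2.1⟩ ≤
      x (.tau ⟨t.1, t.2.1.2.1, t.2.1.2.2⟩)) (d : S.DecPair) :
    S.ampInterference x d ≤ S.slackInterference x d := by
  unfold ampInterference slackInterference
  refine add_le_add (Finset.sum_le_sum fun n'' hn => ?_) le_rfl
  refine mul_le_mul_of_nonneg_left ?_ (mul_nonneg (S.η_nonneg _ _) S.dof_pos.le)
  exact pow_le_pow_left₀ (S.received_nonneg h _ _)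
    (ht ⟨d.1, ⟨(d.2.1.1, d.2.1.2, n''), d.2.2, Finset.ne_of_mem_erase hn⟩⟩) 2

theorem slackInterference_nonneg (x : S.Point) (d : S.DecPair) : 0 ≤ S.slackInterference x d := by
  unfold slackInterference
  refine add_nonneg (Finset.sum_nonneg fun _ _ => ?_)
    (Finset.sum_nonneg fun w _ => Finset.sum_nonneg fun m _ => ?_)
  · exact mul_nonneg (mul_nonneg (S.η_nonneg _ _) S.dof_pos.le) (sq_nonneg _)
  · exact mul_nonneg (mul_nonneg (S.η_nonneg _ _) (sq_nonneg _))
      (sub_nonneg.2 (S.γ_lt_β m _).le)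

theorem ampInterference_nonneg (x : S.Point) (d : S.DecPair) : 0 ≤ S.ampInterference x d := by
  rw [← S.slackInterference_eq (y := x)
    (x := S.ofParts (fun m u => x (.amp m u)) 0 0 0 0 (S.crossReceived x) 0) (fun _ _ => rfl) (fun _ => rfl)]
  exact S.slackInterference_nonneg _ d

theorem amp_le {x : S.Point} {m : Fin S.M} (h : ∑ u : S.UE, x (.amp m u) ^ 2 ≤ S.Pmax m)
    (u : S.UE) : x (.amp m u) ≤ √(S.Pmax m) := by
  refine Real.le_sqrt_of_sq_le (le_trans ?_ h)
  exact Finset.single_le_sum (f := fun u : S.UE => x (.amp m u) ^ 2) (fun _ _ => sq_nonneg _)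
    (Finset.mem_univ u)

/-- An upper bound on the amplitude of any signal at `v`. -/
def receivedBound (v : S.UE) : ℝ := ∑ m, √(S.Pmax m) * √(S.γ m v)

theorem received_le {x : S.Point} (h : ∀ m, ∑ u : S.UE, x (.amp m u) ^ 2 ≤ S.Pmax m)
    (w v : S.UE) : S.received x w v ≤ S.receivedBound v :=
  Finset.sum_le_sum fun m _ => mul_le_mul_of_nonneg_right (S.amp_le (h m) w) (Real.sqrt_nonneg _)

/-! ### Derivatives of the constraints -/

/-- A coordinate as a linear functional. -/
def coord (c : Coord S) : S.Point →L[ℝ] ℝ := ContinuousLinearMap.proj c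

@[simp] theorem coord_apply (c : Coord S) (x : S.Point) : S.coord c x = x c := rfl

theorem hasFDerivAt_coord (c : Coord S) (x : S.Point) :
    HasFDerivAt (fun y : S.Point => y c) (S.coord c) x := (S.coord c).hasFDerivAt

theorem hasFDerivAt_coord_sq (c : Coord S) (x : S.Point) :
    HasFDerivAt (fun y : S.Point => y c ^ 2) ((2 * x c) • S.coord c) x := by
  simpa using (S.hasFDerivAt_coord c x).pow 2

def receivedDeriv (w v : S.UE) : S.Point →L[ℝ] ℝ := ∑ m, √(S.γ m v) • S.coord (.amp m w)

@[simp] theorem receivedDeriv_apply (w v : S.UE) (x : S.Point) :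
    S.receivedDeriv w v x = S.received x w v := by
  simp [receivedDeriv, received, mul_comm]

theorem hasFDerivAt_received (w v : S.UE) (x : S.Point) :
    HasFDerivAt (fun y => S.received y w v) (S.receivedDeriv w v) x := by
  have : (fun y => S.received y w v) = S.receivedDeriv w v :=
    funext fun y => (S.receivedDeriv_apply w v y).symm
  rw [this]
  exact (S.receivedDeriv w v).hasFDerivAt

def objectiveDeriv : S.Point →L[ℝ] ℝ := S.prelog • ∑ u : S.UE, S.coord (.rate u)

@[simp] theorem objectiveDeriv_apply (x : S.Point) : S.objectiveDeriv x = S.objective x := by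
  simp [objectiveDeriv, objective]

theorem hasFDerivAt_objective (x : S.Point) : HasFDerivAt S.objective S.objectiveDeriv x := by
  have : S.objective = S.objectiveDeriv := funext fun y => (S.objectiveDeriv_apply y).symm
  rw [this]
  exact S.objectiveDeriv.hasFDerivAt

theorem continuous_objective : Continuous S.objective :=
  continuous_iff_continuousAt.2 fun x => (S.hasFDerivAt_objective x).continuousAt

def slackInterferenceDeriv (x : S.Point) (d : S.DecPair) : S.Point →L[ℝ] ℝ :=
  (∑ n'' ∈ Finset.univ.erase d.2.1.1, (S.η d.sig ⟨d.1, n''⟩ * S.dof) •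
      ((2 * x (.tau ⟨d.1, d.2.1.2, n''⟩)) • S.coord (.tau ⟨d.1, d.2.1.2, n''⟩))) +
    ∑ w : S.UE, ∑ m, (S.β m d.rx - S.γ m d.rx) •
      (S.η d.sig w • ((2 * x (.amp m w)) • S.coord (.amp m w)))

theorem hasFDerivAt_slackInterference (x : S.Point) (d : S.DecPair) :
    HasFDerivAt (fun y => S.slackInterference y d) (S.slackInterferenceDeriv x d) x := by
  unfold slackInterference slackInterferenceDeriv
  refine HasFDerivAt.add (HasFDerivAt.fun_sum fun n'' _ => ?_)
    (HasFDerivAt.fun_sum fun w _ => HasFDerivAt.fun_sum fun m _ => ?_)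
  · exact (S.hasFDerivAt_coord_sq _ x).const_mul _
  · exact ((S.hasFDerivAt_coord_sq _ x).const_mul _).mul_const _

/-- The derivatives of the constraints at `x`, when those of the bound on the SINR are
`a dϖ + b dθ` and those of the bound on `log (1 + φ)` are `e dφ + h dφ̄`. -/
def constraintDeriv (a b : S.DecPair → ℝ) (e h : S.UE → ℝ) (x : S.Point) :
    Con S → S.Point →L[ℝ] ℝ
  | .signal d => S.receivedDeriv d.sig d.rx - S.coord (.varpi d)
  | .cross t => S.coord (.tau ⟨t.1, t.2.1.2.1, t.2.1.2.2⟩) -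
      S.receivedDeriv ⟨t.1, t.2.1.2.2⟩ ⟨t.1, t.2.1.2.1⟩
  | .interf d => S.coord (.theta d) - S.slackInterferenceDeriv x d
  | .level d => a d • S.coord (.varpi d) + b d • S.coord (.theta d) - S.coord (.phi d.sig)
  | .budget m => -∑ u : S.UE, (2 * x (.amp m u)) • S.coord (.amp m u)
  | .order m p => S.coord (.amp m ⟨p.1, p.2.1.2⟩) - S.coord (.amp m ⟨p.1, p.2.1.1⟩)
  | .nonneg m u => S.coord (.amp m u)
  | .rate u => e u • S.coord (.phi u) + h u • S.coord (.phibar u) - Real.log 2 • S.coord (.rate u)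

theorem hasFDerivAt_constraint {q : S.DecPair → S.Point → ℝ} {f : S.UE → S.Point → ℝ}
    {a b : S.DecPair → ℝ} {e h : S.UE → ℝ} {x : S.Point}
    (hq : ∀ d, HasFDerivAt (q d) (a d • S.coord (.varpi d) + b d • S.coord (.theta d)) x)
    (hf : ∀ u, HasFDerivAt (f u) (e u • S.coord (.phi u) + h u • S.coord (.phibar u)) x)
    (i : Con S) : HasFDerivAt (S.constraint q f i) (S.constraintDeriv a b e h x i) x := by
  cases i with
  | signal d => exact (S.hasFDerivAt_received _ _ x).sub (S.hasFDerivAt_coord _ x)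
  | cross t => exact (S.hasFDerivAt_coord _ x).sub (S.hasFDerivAt_received _ _ x)
  | interf d => exact (S.hasFDerivAt_coord _ x).sub (S.hasFDerivAt_slackInterference x d)
  | level d => exact (hq d).sub (S.hasFDerivAt_coord _ x)
  | budget m =>
    exact (HasFDerivAt.fun_sum fun u _ => S.hasFDerivAt_coord_sq (.amp m u) x).const_sub _
  | order m p => exact (S.hasFDerivAt_coord _ x).sub (S.hasFDerivAt_coord _ x)
  | nonneg m u => exact S.hasFDerivAt_coord _ x
  | rate u => exact (hf u).sub ((S.hasFDerivAt_coord _ x).mul_const _)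

/-! ### The SINR bounds and the rate bounds -/

theorem hasFDerivAt_linearization (d : S.DecPair) (w t : ℝ) (x : S.Point) :
    HasFDerivAt (fun x : S.Point => S.dof * (2 * w / (t + 1) * x (.varpi d) -
          w ^ 2 / (t + 1) ^ 2 * (x (.theta d) + 1)))
      ((S.dof * (2 * w / (t + 1))) • S.coord (.varpi d) +
        (-(S.dof * (w ^ 2 / (t + 1) ^ 2))) • S.coord (.theta d)) x := by
  refine ((((S.hasFDerivAt_coord (.varpi d) x).const_mul (2 * w / (t + 1))).sub
    (((S.hasFDerivAt_coord (.theta d) x).add_const 1).const_mul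
      (w ^ 2 / (t + 1) ^ 2))).const_mul S.dof).congr_fderiv ?_
  ext v
  simp only [smul_apply, sub_apply, add_apply, coord_apply, smul_eq_mul]
  ring

theorem hasFDerivAt_quotient (d : S.DecPair) {x : S.Point} (hx : x (.theta d) + 1 ≠ 0) :
    HasFDerivAt (fun x : S.Point => S.dof * (x (.varpi d) ^ 2 / (x (.theta d) + 1)))
      ((S.dof * (2 * x (.varpi d) / (x (.theta d) + 1))) • S.coord (.varpi d) +
        (-(S.dof * (x (.varpi d) ^ 2 / (x (.theta d) + 1) ^ 2))) • S.coord (.theta d)) x := by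
  have h1 : HasFDerivAt (fun x : S.Point => (x (.theta d) + 1)⁻¹)
      ((-((x (.theta d) + 1) ^ 2)⁻¹) • S.coord (.theta d)) x :=
    (hasDerivAt_inv hx).comp_hasFDerivAt x ((S.hasFDerivAt_coord (.theta d) x).add_const 1)
  have h := ((S.hasFDerivAt_coord_sq (.varpi d) x).mul h1).const_mul S.dof
  simp only [div_eq_mul_inv]
  refine h.congr_fderiv ?_
  ext v
  simp only [smul_apply, add_apply, coord_apply, smul_eq_mul]
  ring

theorem hasFDerivAt_log_phi (u : S.UE) {x : S.Point} (hx : 1 + x (.phi u) ≠ 0) :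
    HasFDerivAt (fun x : S.Point => Real.log (1 + x (.phi u)))
      ((1 + x (.phi u))⁻¹ • S.coord (.phi u) + (0 : ℝ) • S.coord (.phibar u)) x := by
  have h := ((S.hasFDerivAt_coord (.phi u) x).const_add 1).log hx
  simpa using h

theorem hasFDerivAt_affine_phibar (u : S.UE) (k l : ℝ) (x : S.Point) :
    HasFDerivAt (fun x : S.Point => k - l * x (.phibar u))
      ((0 : ℝ) • S.coord (.phi u) + (-l) • S.coord (.phibar u)) x := by
  refine (((S.hasFDerivAt_coord (.phibar u) x).const_mul l).const_sub k).congr_fderiv ?_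
  ext v
  simp

end Network

/-- The linearization of the convex function `v ^ 2 / T` at `(w, t)` is a lower bound. -/
theorem linearization_le_sq_div {w t v T : ℝ} (ht : 0 < t) (hT : 0 < T) :
    2 * w / t * v - w ^ 2 / t ^ 2 * T ≤ v ^ 2 / T := by
  rw [le_div_iff₀ hT]
  -- The gap between the two sides, times `T`, is a perfect square.
  have h : v ^ 2 - (2 * w / t * v - w ^ 2 / t ^ 2 * T) * T = (v - w / t * T) ^ 2 := by
    field_simp
    ring
  nlinarith [sq_nonneg (v - w / t * T)]

/-- The lower bound on `log (1 + p)` that is affine in the inverse `b` of `p`. -/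
theorem affine_inverse_le_log {p₀ p b : ℝ} (h₀ : 0 < p₀) (hp : 0 < p) (hb : 1 ≤ p * b) :
    Real.log (1 + p₀) + p₀ / (p₀ + 1) - p₀ ^ 2 / (p₀ + 1) * b ≤ Real.log (1 + p) := by
  have hb' : p⁻¹ ≤ b := by
    rw [inv_le_iff_one_le_mul₀ hp]; linarith
  have h1 : p₀ ^ 2 / (p₀ + 1) * p⁻¹ ≤ p₀ ^ 2 / (p₀ + 1) * b :=
    mul_le_mul_of_nonneg_left hb' (by positivity)
  -- The tangent bound for `log` compares the two logarithms up to a rational function; the rational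
  -- gap that remains is the nonnegative square in `h4`.
  have h3 : Real.log ((1 + p₀) / (1 + p)) ≤ (1 + p₀) / (1 + p) - 1 :=
    Real.log_le_sub_one_of_pos (by positivity)
  rw [Real.log_div (by positivity) (by positivity)] at h3
  have h4 : (p₀ ^ 2 / (p₀ + 1) * p⁻¹) - p₀ / (p₀ + 1) - ((1 + p₀) / (1 + p) - 1) =
      (p - p₀) ^ 2 / ((1 + p) * (1 + p₀) * p) := by
    field_simp
    ring
  have h5 : 0 ≤ (p - p₀) ^ 2 / ((1 + p) * (1 + p₀) * p) := by positivity
  linarith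

namespace Network

variable {S : Network}

/-! ### Bounds at feasible points -/

namespace IsFeasiblePoint

variable {x : S.Point}

theorem amp_nonneg (hx : S.IsFeasiblePoint x) (m : Fin S.M) (u : S.UE) : 0 ≤ x (.amp m u) :=
  hx.feasible.2 (.nonneg m u)

theorem budget (hx : S.IsFeasiblePoint x) (m : Fin S.M) :
    ∑ u : S.UE, x (.amp m u) ^ 2 ≤ S.Pmax m :=
  sub_nonneg.1 (hx.feasible.2 (.budget m))

theorem order (hx : S.IsFeasiblePoint x) (m : Fin S.M) (p : S.SuccPair) :
    x (.amp m ⟨p.1, p.2.1.1⟩) ≤ x (.amp m ⟨p.1, p.2.1.2⟩) :=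
  sub_nonneg.1 (hx.feasible.2 (.order m p))

theorem varpi_le (hx : S.IsFeasiblePoint x) (d : S.DecPair) :
    x (.varpi d) ≤ S.received x d.sig d.rx :=
  sub_nonneg.1 (hx.feasible.2 (.signal d))

theorem received_le_tau (hx : S.IsFeasiblePoint x) (t : S.Triple) :
    S.received x ⟨t.1, t.2.1.2.2⟩ ⟨t.1, t.2.1.2.1⟩ ≤ x (.tau ⟨t.1, t.2.1.2.1, t.2.1.2.2⟩) :=
  sub_nonneg.1 (hx.feasible.2 (.cross t))

theorem slackInterference_le (hx : S.IsFeasiblePoint x) (d : S.DecPair) :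
    S.slackInterference x d ≤ x (.theta d) :=
  sub_nonneg.1 (hx.feasible.2 (.interf d))

theorem phi_le (hx : S.IsFeasiblePoint x) (d : S.DecPair) :
    x (.phi d.sig) ≤ S.dof * (x (.varpi d) ^ 2 / (x (.theta d) + 1)) :=
  sub_nonneg.1 (hx.feasible.2 (.level d))

theorem rate_le (hx : S.IsFeasiblePoint x) (u : S.UE) :
    x (.rate u) * Real.log 2 ≤ Real.log (1 + x (.phi u)) :=
  sub_nonneg.1 (hx.feasible.2 (.rate u))

theorem theta_nonneg (hx : S.IsFeasiblePoint x) (d : S.DecPair) : 0 ≤ x (.theta d) :=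
  (S.slackInterference_nonneg x d).trans (hx.slackInterference_le d)

theorem ampInterference_le_theta (hx : S.IsFeasiblePoint x) (d : S.DecPair) :
    S.ampInterference x d ≤ x (.theta d) :=
  (S.ampInterference_le hx.amp_nonneg hx.received_le_tau d).trans (hx.slackInterference_le d)

theorem varpi_le_bound (hx : S.IsFeasiblePoint x) (d : S.DecPair) :
    x (.varpi d) ≤ S.receivedBound d.rx :=
  (hx.varpi_le d).trans (S.received_le hx.budget _ _)

theorem phi_le_bound (hx : S.IsFeasiblePoint x) (u : S.UE) :
    x (.phi u) ≤ S.dof * S.receivedBound u ^ 2 := by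
  -- The user decoding its own signal; the noise `1` in the denominator removes the dependence on
  -- `θ`.
  let d : S.DecPair := ⟨u.1, (u.2, u.2), le_rfl⟩
  refine (hx.phi_le d).trans (mul_le_mul_of_nonneg_left ?_ S.dof_pos.le)
  have h0 := hx.theta_nonneg d
  refine (div_le_self (sq_nonneg _) (by linarith)).trans ?_
  exact pow_le_pow_left₀ (hx.varpi_pos d).le (hx.varpi_le_bound d) 2

theorem rate_le_logb (hx : S.IsFeasiblePoint x) (u : S.UE) :
    x (.rate u) ≤ Real.logb 2 (1 + x (.phi u)) := by
  rw [← Real.log_div_log, le_div_iff₀ (Real.log_pos one_lt_two)]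
  exact hx.rate_le u

/-- An upper bound on the rate of a user. -/
def _root_.Network.rateBound (S : Network) (u : S.UE) : ℝ :=
  Real.logb 2 (1 + S.dof * S.receivedBound u ^ 2)

theorem rate_le_bound (hx : S.IsFeasiblePoint x) (u : S.UE) : x (.rate u) ≤ S.rateBound u := by
  have := hx.phi_pos u
  refine (hx.rate_le_logb u).trans (Real.logb_le_logb_of_le one_lt_two (by linarith) ?_)
  linarith [hx.phi_le_bound u]

theorem objective_le_logb (hx : S.IsFeasiblePoint x) :
    S.objective x ≤ S.prelog * ∑ u, Real.logb 2 (1 + x (.phi u)) :=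
  mul_le_mul_of_nonneg_left (Finset.sum_le_sum fun u _ => hx.rate_le_logb u) S.prelog_pos.le

theorem objective_le_bound (hx : S.IsFeasiblePoint x) :
    S.objective x ≤ S.prelog * ∑ u, S.rateBound u :=
  mul_le_mul_of_nonneg_left (Finset.sum_le_sum fun u _ => hx.rate_le_bound u) S.prelog_pos.le

end IsFeasiblePoint

/-! ### Feasible points of the conic quadratic program -/

section CQP

variable {z : S.Iterate} {y : S.Point}

theorem cqp_level_le (hy : (S.cqp z).Feasible y) (d : S.DecPair) :
    y (.phi d.sig) ≤ S.dof * (2 * z.2.1 d / (z.2.2 d + 1) * y (.varpi d) -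
      z.2.1 d ^ 2 / (z.2.2 d + 1) ^ 2 * (y (.theta d) + 1)) :=
  sub_nonneg.1 (hy.2 (.inl (.level d)))

theorem cqp_rate_le (hy : (S.cqp z).Feasible y) (u : S.UE) :
    y (.rate u) * Real.log 2 ≤ Real.log (1 + z.1 u) + z.1 u / (z.1 u + 1) -
      z.1 u ^ 2 / (z.1 u + 1) * y (.phibar u) :=
  sub_nonneg.1 (hy.2 (.inl (.rate u)))

theorem cqp_one_le (hy : (S.cqp z).Feasible y) (u : S.UE) : 1 ≤ y (.phi u) * y (.phibar u) := by
  have h : 0 ≤ 0.25 * (y (.phi u) + y (.phibar u)) ^ 2 -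
      (0.25 * (y (.phi u) - y (.phibar u)) ^ 2 + 1) := hy.2 (.inr u)
  nlinarith

theorem cqp_theta_nonneg (hy : (S.cqp z).Feasible y) (d : S.DecPair) : 0 ≤ y (.theta d) :=
  (S.slackInterference_nonneg y d).trans (sub_nonneg.1 (hy.2 (.inl (.interf d))))

theorem cqp_phibar_pos (hy : (S.cqp z).Feasible y) (u : S.UE) : 0 < y (.phibar u) := by
  have h1 := cqp_one_le hy u
  have h2 : 0 < y (.phi u) := hy.1 u
  by_contra h
  nlinarith

/-- The program built at a feasible point has only feasible points as solutions. -/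
theorem IsFeasiblePoint.of_cqp {x : S.Point} (hx : S.IsFeasiblePoint x)
    (hy : (S.cqp (S.iterate x)).Feasible y) : S.IsFeasiblePoint y := by
  have hphi : ∀ u, 0 < y (.phi u) := hy.1
  have hth := cqp_theta_nonneg hy
  refine ⟨⟨⟨fun u => by linarith [hphi u], fun d => by linarith [hth d]⟩, fun i => ?_⟩,
    hphi, fun d => ?_⟩
  · cases i with
    | signal d => exact hy.2 (.inl (.signal d))
    | cross t => exact hy.2 (.inl (.cross t))
    | interf d => exact hy.2 (.inl (.interf d))
    | budget m => exact hy.2 (.inl (.budget m))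
    | order m p => exact hy.2 (.inl (.order m p))
    | nonneg m u => exact hy.2 (.inl (.nonneg m u))
    | level d =>
      refine sub_nonneg.2 ((cqp_level_le hy d).trans ?_)
      refine mul_le_mul_of_nonneg_left (linearization_le_sq_div ?_ ?_) S.dof_pos.le
      · have : 0 ≤ (S.iterate x).2.2 d := hx.theta_nonneg d
        linarith
      · linarith [hth d]
    | rate u =>
      exact sub_nonneg.2 ((cqp_rate_le hy u).trans
        (affine_inverse_le_log (hx.phi_pos u) (hphi u) (cqp_one_le hy u)))
  -- Positivity of `ϖ` is not a constraint of the program. It follows from `φ > 0`: the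
  -- linearization must be positive, and only its `ϖ` term can contribute positively.
  · have h1 := (hphi _).trans_le (cqp_level_le hy d)
    have h2 := (mul_pos_iff_of_pos_left S.dof_pos).1 h1
    have hw : 0 < (S.iterate x).2.1 d := hx.varpi_pos d
    have ht : 0 ≤ (S.iterate x).2.2 d := hx.theta_nonneg d
    have h3 : 0 ≤ (S.iterate x).2.1 d ^ 2 / ((S.iterate x).2.2 d + 1) ^ 2 * (y (.theta d) + 1) := by
      have := hth d
      positivity
    have h4 : 0 < 2 * (S.iterate x).2.1 d / ((S.iterate x).2.2 d + 1) * y (.varpi d) := by linarith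
    exact (mul_pos_iff_of_pos_left (by positivity)).1 h4

end CQP

/-- The point with the amplitudes, SINR levels, `ϖ` and `θ` of `x` at which the rate and cross
constraints are tight, and with `φ̄ = pb`. -/
def tight (S : Network) (pb : S.UE → ℝ) (x : S.Point) : S.Point :=
  S.ofParts (fun m u => x (.amp m u)) (fun u => Real.logb 2 (1 + x (.phi u)))
    (fun u => x (.phi u)) pb (fun d => x (.varpi d)) (S.crossReceived x) (fun d => x (.theta d))

theorem logb_two_mul_log_two (t : ℝ) : Real.logb 2 t * Real.log 2 = Real.log t := by
  rw [← Real.log_div_log, div_mul_cancel₀ _ (Real.log_pos one_lt_two).ne']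

/-- Lowering `τ` to the received amplitudes can only reduce the interference, and `φ̄` plays no role
in the nonconvex problem, so `pb` is arbitrary. -/
theorem IsFeasiblePoint.tight {x : S.Point} (hx : S.IsFeasiblePoint x) (pb : S.UE → ℝ) :
    S.IsFeasiblePoint (S.tight pb x) := by
  refine ⟨⟨hx.feasible.1, fun i => ?_⟩, hx.phi_pos, hx.varpi_pos⟩
  cases i with
  | signal d => exact hx.feasible.2 (.signal d)
  | cross t => exact sub_nonneg.2 le_rfl
  | interf d =>
    refine sub_nonneg.2 ?_
    rw [S.slackInterference_eq (x := S.tight pb x) (y := x) (fun _ _ => rfl) (fun _ => rfl)]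
    exact hx.ampInterference_le_theta d
  | budget m => exact hx.feasible.2 (.budget m)
  | order m p => exact hx.feasible.2 (.order m p)
  | nonneg m u => exact hx.feasible.2 (.nonneg m u)
  | level d => exact hx.feasible.2 (.level d)
  | rate u => exact sub_nonneg.2 (logb_two_mul_log_two _).le

/-- A feasible point, with its rates raised to their bounds, is feasible for its program. -/
theorem IsFeasiblePoint.cqp_feasible_tight {x : S.Point} (hx : S.IsFeasiblePoint x) :
    (S.cqp (S.iterate x)).Feasible (S.tight (fun u => (x (.phi u))⁻¹) x) := by
  have ht := (hx.tight fun u => (x (.phi u))⁻¹).feasible.2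
  refine ⟨hx.phi_pos, ?_⟩
  rintro (i | u)
  · cases i with
    | signal d => exact ht (.signal d)
    | cross t => exact ht (.cross t)
    | interf d => exact ht (.interf d)
    | budget m => exact ht (.budget m)
    | order m p => exact ht (.order m p)
    | nonneg m u => exact ht (.nonneg m u)
    | level d =>
      have h1 := hx.theta_nonneg d
      refine sub_nonneg.2 ((hx.phi_le d).trans (le_of_eq ?_))
      change _ = S.dof * (2 * x (.varpi d) / (x (.theta d) + 1) * x (.varpi d) -
        x (.varpi d) ^ 2 / (x (.theta d) + 1) ^ 2 * (x (.theta d) + 1))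
      field_simp
      ring
    | rate u =>
      have h1 := hx.phi_pos u
      refine sub_nonneg.2 (le_of_eq ?_)
      change Real.logb 2 (1 + x (.phi u)) * Real.log 2 = Real.log (1 + x (.phi u)) +
        x (.phi u) / (x (.phi u) + 1) - x (.phi u) ^ 2 / (x (.phi u) + 1) * (x (.phi u))⁻¹
      rw [logb_two_mul_log_two]
      field_simp
      ring
  · change 0 ≤ 0.25 * (x (.phi u) + (x (.phi u))⁻¹) ^ 2 -
      (0.25 * (x (.phi u) - (x (.phi u))⁻¹) ^ 2 + 1)
    have h1 : x (.phi u) * (x (.phi u))⁻¹ = 1 := mul_inv_cancel₀ (hx.phi_pos u).ne'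
    nlinarith

/-- The left-hand side is the objective of the tightened current point, a competitor. This is the
source of monotonicity. -/
theorem IsFeasiblePoint.logb_le_of_isOptimal {x y : S.Point} (hx : S.IsFeasiblePoint x)
    (hy : (S.cqp (S.iterate x)).IsOptimal y) :
    S.prelog * ∑ u, Real.logb 2 (1 + x (.phi u)) ≤ S.objective y :=
  hy.2 _ hx.cqp_feasible_tight

/-! ### Existence of optimal solutions -/

theorem hasFDerivAt_cqp_con (z : S.Iterate) (x : S.Point) (i : Con S) :
    HasFDerivAt ((S.cqp z).con (.inl i))
      (S.constraintDeriv (fun d => S.dof * (2 * z.2.1 d / (z.2.2 d + 1)))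
        (fun d => -(S.dof * (z.2.1 d ^ 2 / (z.2.2 d + 1) ^ 2))) 0
        (fun u => -(z.1 u ^ 2 / (z.1 u + 1))) x i) x :=
  S.hasFDerivAt_constraint
    (fun d => S.hasFDerivAt_linearization d (z.2.1 d) (z.2.2 d) x)
    (fun u => S.hasFDerivAt_affine_phibar u _ _ x) i

/-- The cone constraint is `φ φ̄ - 1 ≥ 0` after expanding the squares. -/
theorem hasFDerivAt_cqp_cone (z : S.Iterate) (x : S.Point) (u : S.UE) :
    HasFDerivAt ((S.cqp z).con (.inr u))
      (x (.phibar u) • S.coord (.phi u) + x (.phi u) • S.coord (.phibar u)) x := by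
  have h : (S.cqp z).con (.inr u) = fun y : S.Point => y (.phi u) * y (.phibar u) - 1 := by
    funext y
    change 0.25 * (y (.phi u) + y (.phibar u)) ^ 2 -
      (0.25 * (y (.phi u) - y (.phibar u)) ^ 2 + 1) = _
    ring
  rw [h, add_comm]
  exact ((S.hasFDerivAt_coord _ x).mul (S.hasFDerivAt_coord _ x)).sub_const 1

theorem continuous_cqp_con (z : S.Iterate) (i : Con S ⊕ S.UE) :
    Continuous ((S.cqp z).con i) := by
  refine continuous_iff_continuousAt.2 fun x => ?_
  rcases i with i | u
  · exact (hasFDerivAt_cqp_con z x i).continuousAt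
  · exact (hasFDerivAt_cqp_cone z x u).continuousAt

theorem continuous_received (w v : S.UE) : Continuous fun y : S.Point => S.received y w v :=
  continuous_iff_continuousAt.2 fun x => (S.hasFDerivAt_received w v x).continuousAt

theorem continuous_ampInterference (d : S.DecPair) :
    Continuous fun y : S.Point => S.ampInterference y d := by
  unfold ampInterference crossReceived received
  fun_prop

theorem isCompact_of_bounded_coord {C : Set S.Point} (hC : IsClosed C)
    (h : ∀ c, ∃ B, ∀ y ∈ C, |y c| ≤ B) : IsCompact C := by
  choose B hB using h
  refine (isCompact_Icc (a := -B) (b := B)).of_isClosed_subset hC fun y hy => ?_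
  exact ⟨fun c => (abs_le.1 (hB c y hy)).1, fun c => (abs_le.1 (hB c y hy)).2⟩

/-- The feasible set is not compact: `τ` can grow and rates can fall without bound, and `φ > 0` is
an open condition. Normalizing `τ` and keeping only points at least as good as `x₀` gives a compact
set on which the maximum is the same. -/
theorem IsFeasiblePoint.exists_isOptimal {x : S.Point} (hx : S.IsFeasiblePoint x) :
    ∃ y, (S.cqp (S.iterate x)).IsOptimal y := by
  set z := S.iterate x
  set x₀ := S.tight (fun u => (x (.phi u))⁻¹) x
  have hx₀f : (S.cqp z).Feasible x₀ := hx.cqp_feasible_tight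
  set C : Set S.Point := {y | (∀ u, 0 ≤ y (.phi u)) ∧ (∀ i, 0 ≤ (S.cqp z).con i y) ∧
    (∀ c, y (.tau c) = S.crossReceived y c) ∧ S.objective x₀ ≤ S.objective y} with hC
  have hCf : ∀ y ∈ C, (S.cqp z).Feasible y := by
    rintro y ⟨h1, h2, -, -⟩
    -- The closed condition `φ ≥ 0` suffices in `C`, since the cone constraint excludes `φ = 0`.
    refine ⟨fun u => (h1 u).lt_of_ne fun h0 => ?_, h2⟩
    have h3 : 0 ≤ 0.25 * (y (.phi u) + y (.phibar u)) ^ 2 -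
      (0.25 * (y (.phi u) - y (.phibar u)) ^ 2 + 1) := h2 (.inr u)
    rw [← h0] at h3
    nlinarith
  have hclosed : IsClosed C := by
    simp only [hC, Set.ofPred_and, Set.ofPred_forall]
    refine (isClosed_iInter fun u => ?_).inter ((isClosed_iInter fun i => ?_).inter
      ((isClosed_iInter fun c => ?_).inter ?_))
    · exact isClosed_le continuous_const (continuous_apply _)
    · exact isClosed_le continuous_const (continuous_cqp_con z i)
    · exact isClosed_eq (continuous_apply _) (continuous_received _ _)
    · exact isClosed_le continuous_const S.continuous_objective
  have hcompact : IsCompact C := by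
    refine isCompact_of_bounded_coord hclosed fun c => ?_
    -- The sum of the rates is bounded below by that of `x₀` and each of the other rates is bounded
    -- above, so no single rate can be very negative. Through the rate constraint this also bounds
    -- `φ̄`.
    have hrate : ∀ y ∈ C, ∀ u, ∑ u, x₀ (.rate u) - ∑ v ∈ Finset.univ.erase u, S.rateBound v ≤
        y (.rate u) := by
      intro y hy u
      have h1 := hx.of_cqp (hCf y hy)
      have h2 : ∑ u, x₀ (.rate u) ≤ ∑ u, y (.rate u) :=
        le_of_mul_le_mul_left hy.2.2.2 S.prelog_pos
      rw [← Finset.add_sum_erase _ (fun u => y (.rate u)) (Finset.mem_univ u)] at h2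
      have h3 : ∑ v ∈ Finset.univ.erase u, y (.rate v) ≤
          ∑ v ∈ Finset.univ.erase u, S.rateBound v :=
        Finset.sum_le_sum fun v _ => h1.rate_le_bound v
      linarith
    cases c with
    | amp m u =>
      refine ⟨√(S.Pmax m), fun y hy => ?_⟩
      have h1 := hx.of_cqp (hCf y hy)
      rw [abs_of_nonneg (h1.amp_nonneg m u)]
      exact S.amp_le (h1.budget m) u
    | rate u =>
      refine ⟨max (S.rateBound u)
        (-(∑ u, x₀ (.rate u) - ∑ v ∈ Finset.univ.erase u, S.rateBound v)), fun y hy => ?_⟩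
      have h1 := hx.of_cqp (hCf y hy)
      exact abs_le'.2 ⟨le_max_of_le_left (h1.rate_le_bound u),
        le_max_of_le_right (neg_le_neg (hrate y hy u))⟩
    | phi u =>
      refine ⟨S.dof * S.receivedBound u ^ 2, fun y hy => ?_⟩
      have h1 := hx.of_cqp (hCf y hy)
      rw [abs_of_pos (h1.phi_pos u)]
      exact h1.phi_le_bound u
    | phibar u =>
      refine ⟨(Real.log (1 + z.1 u) + z.1 u / (z.1 u + 1) -
        (∑ u, x₀ (.rate u) - ∑ v ∈ Finset.univ.erase u, S.rateBound v) * Real.log 2) /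
          (z.1 u ^ 2 / (z.1 u + 1)), fun y hy => ?_⟩
      have h2 := cqp_rate_le (hCf y hy) u
      have h3 : 0 < z.1 u := hx.phi_pos u
      have h4 := mul_le_mul_of_nonneg_right (hrate y hy u) (Real.log_pos one_lt_two).le
      rw [abs_of_pos (cqp_phibar_pos (hCf y hy) u), le_div_iff₀ (by positivity)]
      linarith
    | varpi d =>
      refine ⟨S.receivedBound d.rx, fun y hy => ?_⟩
      have h1 := hx.of_cqp (hCf y hy)
      rw [abs_of_pos (h1.varpi_pos d)]
      exact h1.varpi_le_bound d
    | tau c =>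
      refine ⟨S.receivedBound ⟨c.1, c.2.1⟩, fun y hy => ?_⟩
      have h1 := hx.of_cqp (hCf y hy)
      rw [hy.2.2.1 c, crossReceived, abs_of_nonneg (S.received_nonneg h1.amp_nonneg _ _)]
      exact S.received_le h1.budget _ _
    | theta d =>
      -- A large `θ` would make the linearization negative, against `φ > 0`; here it matters that
      -- the expansion point has `ϖ > 0`.
      refine ⟨2 * z.2.1 d / (z.2.2 d + 1) * S.receivedBound d.rx /
        (z.2.1 d ^ 2 / (z.2.2 d + 1) ^ 2), fun y hy => ?_⟩
      have h1 := hx.of_cqp (hCf y hy)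
      have h2 := (mul_pos_iff_of_pos_left S.dof_pos).1
        ((h1.phi_pos _).trans_le (cqp_level_le (hCf y hy) d))
      have h3 : 0 < z.2.1 d := hx.varpi_pos d
      have h4 : 0 ≤ z.2.2 d := hx.theta_nonneg d
      have h5 := mul_le_mul_of_nonneg_left (h1.varpi_le_bound d)
        (show 0 ≤ 2 * z.2.1 d / (z.2.2 d + 1) by positivity)
      have h6 : 0 < z.2.1 d ^ 2 / (z.2.2 d + 1) ^ 2 := by positivity
      rw [abs_of_nonneg (h1.theta_nonneg d), le_div_iff₀ h6]
      linarith
  obtain ⟨y, hy, hmax⟩ := hcompact.exists_isMaxOn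
    ⟨x₀, fun u => (hx.phi_pos u).le, hx₀f.2, fun _ => rfl, le_rfl⟩
    S.continuous_objective.continuousOn
  refine ⟨y, hCf y hy, fun w hw => ?_⟩
  rcases le_total (S.objective w) (S.objective x₀) with hle | hle
  · exact hle.trans hy.2.2.2
  have hwf := hx.of_cqp hw
  -- Any better competitor may be replaced by its version with tight `τ`, which has the same
  -- objective and lies in `C`.
  set w' := S.ofParts (fun m u => w (.amp m u)) (fun u => w (.rate u)) (fun u => w (.phi u))
    (fun u => w (.phibar u)) (fun d => w (.varpi d)) (S.crossReceived w) (fun d => w (.theta d))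
  suffices hwC : w' ∈ C from isMaxOn_iff.1 hmax w' hwC
  refine ⟨fun u => (hw.1 u).le, ?_, fun _ => rfl, hle⟩
  rintro (i | u)
  · cases i with
    | cross t => exact sub_nonneg.2 le_rfl
    | interf d =>
      refine sub_nonneg.2 ?_
      rw [S.slackInterference_eq (x := w') (y := w) (fun _ _ => rfl) (fun _ => rfl)]
      exact hwf.ampInterference_le_theta d
    | signal d => exact hw.2 (.inl (.signal d))
    | budget m => exact hw.2 (.inl (.budget m))
    | order m p => exact hw.2 (.inl (.order m p))
    | nonneg m u => exact hw.2 (.inl (.nonneg m u))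
    | level d => exact hw.2 (.inl (.level d))
    | rate u => exact hw.2 (.inl (.rate u))
  · exact hw.2 (.inr u)

end Network

namespace Network

variable {S : Network}

/-! ### The original problem -/

theorem sqrt_powers_mul {x : S.Point} (h : ∀ m u, 0 ≤ x (.amp m u)) (w v : S.UE) :
    ∑ m, √(S.powers x m w * S.γ m v) = S.received x w v := by
  refine Finset.sum_congr rfl fun m _ => ?_
  rw [powers, Real.sqrt_mul (sq_nonneg _), Real.sqrt_sq (h m w)]

theorem interference_powers {x : S.Point} (h : ∀ m u, 0 ≤ x (.amp m u)) (d : S.DecPair) :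
    S.interference (S.powers x) d = S.ampInterference x d := by
  simp only [interference, ampInterference, sqrt_powers_mul h]
  rfl

theorem IsFeasiblePoint.phi_le_amp {x : S.Point} (hx : S.IsFeasiblePoint x) (d : S.DecPair) :
    x (.phi d.sig) ≤ S.dof * S.received x d.sig d.rx ^ 2 / (S.ampInterference x d + 1) := by
  have h1 := S.ampInterference_nonneg x d
  have h2 := hx.ampInterference_le_theta d
  have h3 := S.dof_pos
  refine (hx.phi_le d).trans ?_
  rw [mul_div_assoc]
  refine mul_le_mul_of_nonneg_left ?_ h3.le
  refine div_le_div₀ (sq_nonneg _) ?_ (by linarith) (by linarith)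
  exact pow_le_pow_left₀ (hx.varpi_pos d).le (hx.varpi_le d) 2

theorem IsFeasiblePoint.sumSEFeasible {x : S.Point} (hx : S.IsFeasiblePoint x) :
    S.SumSEFeasible (S.powers x) (fun u => x (.rate u)) (fun u => x (.phi u)) where
  nonneg m u := sq_nonneg _
  budget := hx.budget
  order m p := pow_le_pow_left₀ (hx.amp_nonneg m _) (hx.order m p) 2
  phi_dom := hx.feasible.1.1
  rate := hx.rate_le
  sinr_ge d := by
    rw [sinr, sqrt_powers_mul hx.amp_nonneg, interference_powers hx.amp_nonneg]
    exact hx.phi_le_amp d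

/-! ### Runs of the algorithm -/

theorem IsFeasiblePoint.exists_isRun {x₀ : S.Point} (h₀ : S.IsFeasiblePoint x₀) :
    ∃ x : ℕ → S.Point, x 0 = x₀ ∧ S.IsRun x := by
  choose next hnext using fun p : {x : S.Point // S.IsFeasiblePoint x} => p.2.exists_isOptimal
  let step : {x : S.Point // S.IsFeasiblePoint x} → {x : S.Point // S.IsFeasiblePoint x} :=
    fun p => ⟨next p, p.2.of_cqp (hnext p).1⟩
  refine ⟨fun κ => (step^[κ] ⟨x₀, h₀⟩).1, rfl, fun κ => ?_⟩
  dsimp only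
  rw [Function.iterate_succ_apply']
  exact hnext _

namespace IsRun

variable {x : ℕ → S.Point}

theorem isFeasiblePoint (hx : S.IsRun x) (h₀ : S.IsFeasiblePoint (x 0)) (κ : ℕ) :
    S.IsFeasiblePoint (x κ) := by
  induction κ with
  | zero => exact h₀
  | succ κ ih => exact ih.of_cqp (hx κ).1

theorem logb_le (hx : S.IsRun x) (h₀ : S.IsFeasiblePoint (x 0)) (κ : ℕ) :
    S.prelog * ∑ u, Real.logb 2 (1 + x κ (.phi u)) ≤ S.objective (x (κ + 1)) :=
  (hx.isFeasiblePoint h₀ κ).logb_le_of_isOptimal (hx κ)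

theorem monotone (hx : S.IsRun x) (h₀ : S.IsFeasiblePoint (x 0)) :
    Monotone fun κ => S.objective (x κ) :=
  monotone_nat_of_le_succ fun κ =>
    (hx.isFeasiblePoint h₀ κ).objective_le_logb.trans (hx.logb_le h₀ κ)

theorem exists_tendsto (hx : S.IsRun x) (h₀ : S.IsFeasiblePoint (x 0)) :
    ∃ R : ℝ, Tendsto (fun κ => S.objective (x κ)) atTop (𝓝 R) :=
  ⟨_, tendsto_atTop_ciSup (hx.monotone h₀) ⟨S.prelog * ∑ u, S.rateBound u, by
    rintro _ ⟨κ, rfl⟩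
    exact (hx.isFeasiblePoint h₀ κ).objective_le_bound⟩⟩

theorem exists_stops (hx : S.IsRun x) (h₀ : S.IsFeasiblePoint (x 0)) {ε : ℝ} (hε : 0 < ε) :
    ∃ κ₀, ∀ κ, κ₀ ≤ κ → S.Stops ε (x (κ + 1)) (x (κ + 2)) := by
  rcases isEmpty_or_nonempty S.UE with hE | hE
  · exact ⟨0, fun κ _ => by simpa [Stops] using hε⟩
  have hp := S.prelog_pos
  have hsum : ∀ κ, ∑ u, x κ (.rate u) = S.objective (x κ) / S.prelog := fun κ => by
    rw [objective, mul_div_cancel_left₀ _ hp.ne']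
  -- The initial rates are arbitrary and may have sum zero or negative, but the levels are positive.
  -- Hence `b` is a positive lower bound on all later sums, and the rule is tested from `x (κ + 1)`
  -- on.
  set b := ∑ u, Real.logb 2 (1 + x 0 (.phi u))
  have hbpos : 0 < b := Finset.sum_pos (fun u _ =>
    Real.logb_pos one_lt_two (by linarith [h₀.phi_pos u])) Finset.univ_nonempty
  have hlow : ∀ κ, b ≤ ∑ u, x (κ + 1) (.rate u) := fun κ => by
    rw [hsum, le_div_iff₀ hp, mul_comm]
    exact (hx.logb_le h₀ 0).trans (hx.monotone h₀ (Nat.le_add_left 1 κ))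
  obtain ⟨R, hR⟩ := hx.exists_tendsto h₀
  have hdiff : Tendsto (fun κ => (S.objective (x (κ + 2)) - S.objective (x (κ + 1))) / S.prelog)
      atTop (𝓝 0) := by
    simpa using (((tendsto_add_atTop_iff_nat 2).2 hR).sub
      ((tendsto_add_atTop_iff_nat 1).2 hR)).div_const S.prelog
  obtain ⟨κ₀, h⟩ := eventually_atTop.1 (hdiff.eventually (gt_mem_nhds (mul_pos hε hbpos)))
  refine ⟨κ₀, fun κ hκ => ?_⟩
  have h1 := h κ hκ
  rw [sub_div, ← hsum, ← hsum] at h1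
  unfold Stops
  rw [div_lt_iff₀ (hbpos.trans_le (hlow κ))]
  exact h1.trans_le (mul_le_mul_of_nonneg_left (hlow κ) hε.le)

end IsRun

/-! ### The constraint qualification and the KKT conditions of the programs -/

/-- The direction points from `x` to the profile `s m * (n + 1)`, which is positive, strictly
increasing along each cluster and, for small `s m`, strictly within the budget. Each of these
constraints strictly improves towards it when active. -/
theorem exists_amp_direction (x : S.Point) :
    ∃ a : Fin S.M → S.UE → ℝ,
      (∀ m, ∑ u, x (.amp m u) ^ 2 = S.Pmax m → ∑ u, x (.amp m u) * a m u < 0) ∧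
      (∀ m (p : S.SuccPair), x (.amp m ⟨p.1, p.2.1.1⟩) = x (.amp m ⟨p.1, p.2.1.2⟩) →
        a m ⟨p.1, p.2.1.1⟩ < a m ⟨p.1, p.2.1.2⟩) ∧
      ∀ m u, x (.amp m u) = 0 → 0 < a m u := by
  have hs : ∀ m, ∃ s : ℝ, 0 < s ∧ ∑ u : S.UE, (s * ((u.2 : ℕ) + 1 : ℝ)) ^ 2 < S.Pmax m := by
    intro m
    have hc : Tendsto (fun s : ℝ => ∑ u : S.UE, (s * ((u.2 : ℕ) + 1 : ℝ)) ^ 2) (𝓝[>] 0) (𝓝 0) := by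
      have := (by fun_prop : Continuous fun s : ℝ =>
        ∑ u : S.UE, (s * ((u.2 : ℕ) + 1 : ℝ)) ^ 2).tendsto 0
      simp only [zero_mul, ne_eq, OfNat.ofNat_ne_zero, not_false_eq_true, zero_pow,
        Finset.sum_const_zero] at this
      exact this.mono_left nhdsWithin_le_nhds
    obtain ⟨s, h1, h2⟩ := ((hc.eventually (gt_mem_nhds (S.Pmax_pos m))).and
      self_mem_nhdsWithin).exists
    exact ⟨s, h2, h1⟩
  choose s hs0 hs1 using hs
  refine ⟨fun m u => s m * ((u.2 : ℕ) + 1 : ℝ) - x (.amp m u), fun m hm => ?_, fun m p hp => ?_,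
    fun m u hu => ?_⟩
  -- This is `x (t - x) ≤ (t² - x²) / 2`, so the strict power gap of the target decides the sign.
  · have h1 : ∑ u : S.UE, x (.amp m u) * (s m * ((u.2 : ℕ) + 1 : ℝ) - x (.amp m u)) ≤
        ∑ u : S.UE, ((s m * ((u.2 : ℕ) + 1 : ℝ)) ^ 2 - x (.amp m u) ^ 2) / 2 :=
      Finset.sum_le_sum fun u _ => by
        nlinarith [sq_nonneg (x (.amp m u) - s m * ((u.2 : ℕ) + 1 : ℝ))]
    rw [← Finset.sum_div, Finset.sum_sub_distrib, hm] at h1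
    linarith [hs1 m]
  · have h1 : ((p.2.1.2 : ℕ) : ℝ) = (p.2.1.1 : ℕ) + 1 := by exact_mod_cast p.2.2
    have := hs0 m
    dsimp only
    rw [h1, hp]
    nlinarith
  · have := hs0 m
    dsimp only
    rw [hu, sub_zero]
    positivity

/-- The Mangasarian-Fromovitz constraint qualification holds at every point. -/
theorem exists_constraint_direction (q : S.DecPair → S.Point → ℝ) (f : S.UE → S.Point → ℝ)
    (a b : S.DecPair → ℝ) (e h : S.UE → ℝ) (x : S.Point) :
    ∃ v : S.Point, (∀ i, S.constraint q f i x = 0 → 0 < S.constraintDeriv a b e h x i v) ∧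
      ∀ u, 0 < x (.phi u) → 0 < x (.phibar u) * v (.phi u) + x (.phi u) * v (.phibar u) := by
  obtain ⟨α, hbud, hord, hnon⟩ := exists_amp_direction x
  let v₁ : S.Point := S.ofParts α 0 0 0 0 0 0
  -- The derivative of the interference sees only the amplitude and `τ` components, so it can be
  -- evaluated at `v₂` before `θ` is chosen.
  let v₂ : S.Point := S.ofParts α 0 0 0 0 (fun c => S.crossReceived v₁ c + 1) 0
  let th : S.DecPair → ℝ := fun d => S.slackInterferenceDeriv x d v₂ + 1
  let vp : S.DecPair → ℝ := fun d => S.received v₁ d.sig d.rx - 1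
  -- One common decrease of all `φ` that beats every level constraint by at least `1`. Then `pb`
  -- makes the derivative of the cone constraint equal to `1` where `φ > 0`, and `r` leaves the
  -- margin `1` in each rate constraint.
  let p : ℝ := -1 - ∑ d, |a d * vp d + b d * th d|
  let pb : S.UE → ℝ := fun u => (1 - x (.phibar u) * p) / x (.phi u)
  let r : S.UE → ℝ := fun u => (e u * p + h u * pb u - 1) / Real.log 2
  let v : S.Point := S.ofParts α r (fun _ => p) pb vp (fun c => S.crossReceived v₁ c + 1) th
  have hrec : ∀ w u, S.received v w u = S.received v₁ w u :=
    S.received_congr fun _ _ => rfl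
  refine ⟨v, fun i hi => ?_, fun u hu => ?_⟩
  · cases i with
    | signal d =>
      simp only [constraintDeriv, sub_apply, receivedDeriv_apply, coord_apply, hrec]
      change 0 < _ - (_ - 1)
      linarith
    | cross t =>
      simp only [constraintDeriv, sub_apply, receivedDeriv_apply, coord_apply, hrec]
      change 0 < S.received v₁ _ _ + 1 - _
      linarith
    | interf d =>
      have h1 : S.slackInterferenceDeriv x d v = S.slackInterferenceDeriv x d v₂ := by
        simp only [slackInterferenceDeriv, add_apply, sum_apply, smul_apply, coord_apply]
        rfl
      simp only [constraintDeriv, sub_apply, coord_apply, h1]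
      change 0 < _ + 1 - _
      linarith
    | level d =>
      simp only [constraintDeriv, sub_apply, add_apply, smul_apply, coord_apply, smul_eq_mul]
      change 0 < a d * vp d + b d * th d - p
      have h1 : |a d * vp d + b d * th d| ≤ ∑ d, |a d * vp d + b d * th d| :=
        Finset.single_le_sum (f := fun d => |a d * vp d + b d * th d|)
          (fun _ _ => abs_nonneg _) (Finset.mem_univ d)
      have h2 := neg_abs_le (a d * vp d + b d * th d)
      simp only [p]
      linarith
    | budget m =>
      have h1 := hbud m (sub_eq_zero.1 hi).symm
      simp only [constraintDeriv, neg_apply, sum_apply, smul_apply, coord_apply, smul_eq_mul]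
      change 0 < -∑ u, 2 * x (.amp m u) * α m u
      simp only [mul_assoc, ← Finset.mul_sum]
      linarith
    | order m p => exact sub_pos.2 (hord m p (sub_eq_zero.1 hi).symm)
    | nonneg m u => exact hnon m u hi
    | rate u =>
      simp only [constraintDeriv, sub_apply, add_apply, smul_apply, coord_apply, smul_eq_mul]
      change 0 < e u * p + h u * pb u - Real.log 2 * ((e u * p + h u * pb u - 1) / Real.log 2)
      rw [mul_div_cancel₀ _ (Real.log_pos one_lt_two).ne']
      linarith
  · change 0 < x (.phibar u) * p + x (.phi u) * ((1 - x (.phibar u) * p) / x (.phi u))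
    rw [mul_div_cancel₀ _ hu.ne']
    linarith

theorem isKKT_of_isOptimal_cqp {z : S.Iterate} {y : S.Point} (hy : (S.cqp z).IsOptimal y) :
    (S.cqp z).IsKKT y := by
  have hphi : ∀ u, 0 < y (.phi u) := hy.1.1
  have hdom : (S.cqp z).dom ∈ 𝓝 y := by
    refine IsOpen.mem_nhds ?_ hy.1.1
    change IsOpen {x : S.Point | ∀ u, 0 < x (.phi u)}
    simp only [Set.ofPred_forall]
    exact isOpen_iInter_of_finite fun u => isOpen_lt continuous_const (continuous_apply _)
  obtain ⟨v, hv1, hv2⟩ := exists_constraint_direction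
    (fun d x => S.dof * (2 * z.2.1 d / (z.2.2 d + 1) * x (.varpi d) -
          z.2.1 d ^ 2 / (z.2.2 d + 1) ^ 2 * (x (.theta d) + 1)))
    (fun u x => Real.log (1 + z.1 u) + z.1 u / (z.1 u + 1) -
        z.1 u ^ 2 / (z.1 u + 1) * x (.phibar u))
    (fun d => S.dof * (2 * z.2.1 d / (z.2.2 d + 1)))
    (fun d => -(S.dof * (z.2.1 d ^ 2 / (z.2.2 d + 1) ^ 2))) 0
    (fun u => -(z.1 u ^ 2 / (z.1 u + 1))) y
  let g' : Con S ⊕ S.UE → S.Point →L[ℝ] ℝ := Sum.elim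
    (S.constraintDeriv (fun d => S.dof * (2 * z.2.1 d / (z.2.2 d + 1)))
      (fun d => -(S.dof * (z.2.1 d ^ 2 / (z.2.2 d + 1) ^ 2))) 0
      (fun u => -(z.1 u ^ 2 / (z.1 u + 1))) y)
    (fun u => y (.phibar u) • S.coord (.phi u) + y (.phi u) • S.coord (.phibar u))
  refine hy.isKKT (g' := g') hdom (S.hasFDerivAt_objective y) ?_ ⟨v, ?_⟩
  · rintro (i | u)
    · exact hasFDerivAt_cqp_con z y i
    · exact hasFDerivAt_cqp_cone z y u
  · rintro (i | u) h
    · exact hv1 i h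
    · exact hv2 u (hphi u)

end Network

namespace Network

variable {S : Network}

/-! ### Limits of the iterates -/

/-- The derivatives of the constraints of the nonconvex problem. -/
def slackDeriv (y : S.Point) : Con S → S.Point →L[ℝ] ℝ :=
  S.constraintDeriv (fun d => S.dof * (2 * y (.varpi d) / (y (.theta d) + 1)))
    (fun d => -(S.dof * (y (.varpi d) ^ 2 / (y (.theta d) + 1) ^ 2)))
    (fun u => (1 + y (.phi u))⁻¹) 0 y

theorem hasFDerivAt_slackProblem_con {y : S.Point} (hy : y ∈ S.slackProblem.dom) (i : Con S) :
    HasFDerivAt (S.slackProblem.con i) (S.slackDeriv y i) y :=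
  S.hasFDerivAt_constraint
    (fun d => S.hasFDerivAt_quotient d (by have := hy.2 d; linarith))
    (fun u => S.hasFDerivAt_log_phi u (by have := hy.1 u; linarith)) i

/-- `y` is the limit along `l` of the points of the sequence `x`, normalized so that their rates
and their slack variables `τ` are determined by the other variables. -/
structure IsLimit (x : ℕ → S.Point) (l : Filter ℕ) (y : S.Point) : Prop where
  tendsto : Tendsto (fun κ => S.tight 0 (x κ)) l (𝓝 y)
  rate : ∀ u, y (.rate u) = Real.logb 2 (1 + y (.phi u))

namespace IsLimit

variable {x : ℕ → S.Point} {l : Filter ℕ} {y : S.Point}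

theorem tendsto_coord (h : IsLimit x l y) (c : Coord S) :
    Tendsto (fun κ => S.tight 0 (x κ) c) l (𝓝 (y c)) :=
  (continuous_apply c).continuousAt.tendsto.comp h.tendsto

theorem tendsto_phi (h : IsLimit x l y) (u : S.UE) :
    Tendsto (fun κ => x κ (.phi u)) l (𝓝 (y (.phi u))) := h.tendsto_coord (.phi u)

theorem tendsto_varpi (h : IsLimit x l y) (d : S.DecPair) :
    Tendsto (fun κ => x κ (.varpi d)) l (𝓝 (y (.varpi d))) := h.tendsto_coord (.varpi d)

theorem tendsto_theta (h : IsLimit x l y) (d : S.DecPair) :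
    Tendsto (fun κ => x κ (.theta d)) l (𝓝 (y (.theta d))) := h.tendsto_coord (.theta d)

variable [l.NeBot]

theorem phi_nonneg (h : IsLimit x l y) (hx : ∀ κ, S.IsFeasiblePoint (x κ)) (u : S.UE) :
    0 ≤ y (.phi u) :=
  ge_of_tendsto' (h.tendsto_phi u) fun κ => ((hx κ).phi_pos u).le

theorem varpi_nonneg (h : IsLimit x l y) (hx : ∀ κ, S.IsFeasiblePoint (x κ)) (d : S.DecPair) :
    0 ≤ y (.varpi d) :=
  ge_of_tendsto' (h.tendsto_varpi d) fun κ => ((hx κ).varpi_pos d).le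

theorem theta_nonneg (h : IsLimit x l y) (hx : ∀ κ, S.IsFeasiblePoint (x κ)) (d : S.DecPair) :
    0 ≤ y (.theta d) :=
  ge_of_tendsto' (h.tendsto_theta d) fun κ => (hx κ).theta_nonneg d

/-- The constraints are continuous at `y` and hold at the normalized points, which are the ones that
converge: the original `τ` and rates need not. -/
theorem feasible (h : IsLimit x l y) (hx : ∀ κ, S.IsFeasiblePoint (x κ)) :
    S.slackProblem.Feasible y := by
  have hdom : y ∈ S.slackProblem.dom :=
    ⟨fun u => by linarith [h.phi_nonneg hx u], fun d => by linarith [h.theta_nonneg hx d]⟩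
  refine ⟨hdom, fun i => ge_of_tendsto'
    ((hasFDerivAt_slackProblem_con hdom i).continuousAt.tendsto.comp h.tendsto) fun κ => ?_⟩
  exact ((hx κ).tight 0).feasible.2 i

end IsLimit
end Network

/-! ### Comparing points near the limit with the programs of the run -/

namespace Network

variable {S : Network}

namespace IsLimit

variable {x : ℕ → S.Point} {l : Filter ℕ} {y w : S.Point} [l.NeBot]

/-- The increasing values are at most their limit over the whole run, which can be computed along
`l`; there each value is at most the sum of `logb 2 (1 + φ)`. -/
theorem objective_le (h : IsLimit x l y) (hl : l ≤ atTop) (hrun : S.IsRun x)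
    (h₀ : S.IsFeasiblePoint (x 0)) (κ : ℕ) :
    S.objective (x κ) ≤ S.prelog * ∑ u, Real.logb 2 (1 + y (.phi u)) := by
  have hx := hrun.isFeasiblePoint h₀
  obtain ⟨R, hR⟩ := hrun.exists_tendsto h₀
  refine ((hrun.monotone h₀).ge_of_tendsto hR κ).trans ?_
  refine le_of_tendsto_of_tendsto' (hR.mono_left hl) (Tendsto.const_mul _ (tendsto_finsetSum _
    fun u _ => ?_)) fun κ => (hx κ).objective_le_logb
  have h1 := h.phi_nonneg hx u
  exact ((h.tendsto_phi u).const_add 1).logb (by linarith)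

theorem tendsto_linearization (h : IsLimit x l y) (hx : ∀ κ, S.IsFeasiblePoint (x κ))
    (d : S.DecPair) (r i : ℝ) :
    Tendsto (fun κ => S.dof * (2 * x κ (.varpi d) / (x κ (.theta d) + 1) * r -
        x κ (.varpi d) ^ 2 / (x κ (.theta d) + 1) ^ 2 * i)) l
      (𝓝 (S.dof * (2 * y (.varpi d) / (y (.theta d) + 1) * r -
        y (.varpi d) ^ 2 / (y (.theta d) + 1) ^ 2 * i))) := by
  have h1 := h.theta_nonneg hx d
  have h2 := (h.tendsto_theta d).add_const 1
  have h3 := h.tendsto_varpi d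
  exact ((((h3.const_mul 2).div h2 (by linarith)).mul_const r).sub
    (((h3.pow 2).div (h2.pow 2) (by positivity)).mul_const i)).const_mul _

/-- A user whose SINR level tends to `0` can keep the levels of the iterates while the amplitudes
are those of `w`. -/
theorem eventually_phi_le (h : IsLimit x l y) (hx : ∀ κ, S.IsFeasiblePoint (x κ)) {d : S.DecPair}
    {r i : ℝ} (hphi : y (.phi d.sig) = 0)
    (hw : 0 < 2 * r - y (.varpi d) / (y (.theta d) + 1) * i) :
    ∀ᶠ κ in l, x κ (.phi d.sig) ≤
      S.dof * (2 * x κ (.varpi d) / (x κ (.theta d) + 1) * r -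
        x κ (.varpi d) ^ 2 / (x κ (.theta d) + 1) ^ 2 * i) := by
  have hdof := S.dof_pos
  have h1 := h.theta_nonneg hx d
  -- If `ϖ → 0`, the level of the iterate is of second order in its `ϖ` while the linearization at
  -- fixed `r > 0` is of first order. If `ϖ` has a positive limit, the linearization has one too,
  -- while `φ → 0`.
  rcases (h.varpi_nonneg hx d).eq_or_lt with h0 | h0
  · rw [← h0, zero_div, zero_mul, sub_zero] at hw
    have h2 : Tendsto (fun κ => 2 * r - x κ (.varpi d) / (x κ (.theta d) + 1) * i -
        x κ (.varpi d)) l (𝓝 (2 * r - 0 / (y (.theta d) + 1) * i - 0)) := by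
      have h3 := h.tendsto_varpi d
      rw [← h0] at h3
      exact (((h3.div ((h.tendsto_theta d).add_const 1) (by linarith)).mul_const i).const_sub
        _).sub h3
    rw [zero_div, zero_mul, sub_zero, sub_zero] at h2
    filter_upwards [h2.eventually (lt_mem_nhds hw)] with κ hκ
    refine ((hx κ).phi_le d).trans (mul_le_mul_of_nonneg_left ?_ hdof.le)
    have h3 := (hx κ).theta_nonneg d
    have h4 := (hx κ).varpi_pos d
    have h5 : 2 * x κ (.varpi d) / (x κ (.theta d) + 1) * r -
        x κ (.varpi d) ^ 2 / (x κ (.theta d) + 1) ^ 2 * i -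
        x κ (.varpi d) ^ 2 / (x κ (.theta d) + 1) =
        x κ (.varpi d) / (x κ (.theta d) + 1) *
          (2 * r - x κ (.varpi d) / (x κ (.theta d) + 1) * i - x κ (.varpi d)) := by
      field_simp
    rw [← sub_nonneg, h5]
    positivity
  · have h2 := h.tendsto_phi d.sig
    rw [hphi] at h2
    refine (h2.eventually_lt (h.tendsto_linearization hx d r i) ?_).mono fun κ hκ => hκ.le
    have h5 : S.dof * (2 * y (.varpi d) / (y (.theta d) + 1) * r -
        y (.varpi d) ^ 2 / (y (.theta d) + 1) ^ 2 * i) =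
        S.dof * (y (.varpi d) / (y (.theta d) + 1) *
          (2 * r - y (.varpi d) / (y (.theta d) + 1) * i)) := by
      field_simp
    rw [h5]
    positivity

open Classical in
/-- Amplitudes, rates and levels that strictly satisfy the constraints of the program built at the
limit `y`, restricted to the users with `0 < φ` at `y`, do not improve on `y`. -/
theorem rate_sum_le (h : IsLimit x l y) (hl : l ≤ atTop) (hrun : S.IsRun x)
    (h₀ : S.IsFeasiblePoint (x 0)) (hamp : ∀ m u, 0 ≤ w (.amp m u))
    (hbud : ∀ m, ∑ u : S.UE, w (.amp m u) ^ 2 ≤ S.Pmax m)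
    (hord : ∀ m (p : S.SuccPair), w (.amp m ⟨p.1, p.2.1.1⟩) ≤ w (.amp m ⟨p.1, p.2.1.2⟩))
    (hphi : ∀ u, 0 < y (.phi u) → 0 < w (.phi u))
    (hlevel : ∀ d : S.DecPair, 0 < y (.phi d.sig) → w (.phi d.sig) <
      S.dof * (2 * y (.varpi d) / (y (.theta d) + 1) * S.received w d.sig d.rx -
        y (.varpi d) ^ 2 / (y (.theta d) + 1) ^ 2 * (S.ampInterference w d + 1)))
    (hzero : ∀ d : S.DecPair, ¬ 0 < y (.phi d.sig) → 0 < 2 * S.received w d.sig d.rx -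
      y (.varpi d) / (y (.theta d) + 1) * (S.ampInterference w d + 1))
    (hrate : ∀ u, 0 < y (.phi u) → w (.rate u) * Real.log 2 < Real.log (1 + y (.phi u)) +
      y (.phi u) / (y (.phi u) + 1) - y (.phi u) ^ 2 / (y (.phi u) + 1) * (w (.phi u))⁻¹) :
    S.prelog * ∑ u, (if 0 < y (.phi u) then w (.rate u) else 0) ≤
      S.prelog * ∑ u, Real.logb 2 (1 + y (.phi u)) := by
  have hx := hrun.isFeasiblePoint h₀
  -- Users with a positive limit level take their data from `w`; the others copy the level of
  -- iterate `κ`, with the rate at which the logarithmic bound is exact. Copying keeps `φ̄ = 1 / φ`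
  -- finite for each program, although it diverges in the limit.
  let p : ℕ → S.UE → ℝ := fun κ u => if 0 < y (.phi u) then w (.phi u) else x κ (.phi u)
  let r : ℕ → S.UE → ℝ := fun κ u =>
    if 0 < y (.phi u) then w (.rate u) else Real.logb 2 (1 + x κ (.phi u))
  let Y : ℕ → S.Point := fun κ => S.ofParts (fun m u => w (.amp m u)) (r κ) (p κ)
    (fun u => (p κ u)⁻¹) (fun d => S.received w d.sig d.rx) (S.crossReceived w)
    (S.ampInterference w)
  have hp : ∀ κ u, 0 < p κ u := fun κ u => by
    simp only [p]
    split_ifs with hu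
    · exact hphi u hu
    · exact (hx κ).phi_pos u
  have hev1 : ∀ᶠ κ in l, ∀ d : S.DecPair, p κ d.sig ≤
      S.dof * (2 * x κ (.varpi d) / (x κ (.theta d) + 1) * S.received w d.sig d.rx -
        x κ (.varpi d) ^ 2 / (x κ (.theta d) + 1) ^ 2 * (S.ampInterference w d + 1)) := by
    refine eventually_all.2 fun d => ?_
    by_cases hd : 0 < y (.phi d.sig)
    · simp only [p, if_pos hd]
      exact ((h.tendsto_linearization hx d _ _).eventually (lt_mem_nhds (hlevel d hd))).mono
        fun κ hκ => hκ.le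
    · simp only [p, if_neg hd]
      exact h.eventually_phi_le hx (le_antisymm (not_lt.1 hd) (h.phi_nonneg hx _)) (hzero d hd)
  have hev2 : ∀ᶠ κ in l, ∀ u, r κ u * Real.log 2 ≤ Real.log (1 + x κ (.phi u)) +
      x κ (.phi u) / (x κ (.phi u) + 1) - x κ (.phi u) ^ 2 / (x κ (.phi u) + 1) * (p κ u)⁻¹ := by
    refine eventually_all.2 fun u => ?_
    by_cases hu : 0 < y (.phi u)
    · simp only [p, r, if_pos hu]
      have h1 := h.tendsto_phi u
      have h2 := h1.add_const 1
      have h3 := (((h1.const_add 1).log (by positivity)).add (h1.div h2 (by positivity))).sub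
        (((h1.pow 2).div h2 (by positivity)).mul_const (w (.phi u))⁻¹)
      exact (h3.eventually (lt_mem_nhds (hrate u hu))).mono fun κ hκ => hκ.le
    · simp only [p, r, if_neg hu]
      refine Eventually.of_forall fun κ => ?_
      have h1 := (hx κ).phi_pos u
      rw [logb_two_mul_log_two]
      refine le_of_eq ?_
      field_simp
      ring
  obtain ⟨κ, h1, h2⟩ := (hev1.and hev2).exists
  have hY : (S.cqp (S.iterate (x κ))).Feasible (Y κ) := by
    refine ⟨hp κ, ?_⟩
    rintro (i | u)
    · cases i with
      | signal d => exact sub_nonneg.2 le_rfl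
      | cross t => exact sub_nonneg.2 le_rfl
      | interf d =>
        refine sub_nonneg.2 (le_of_eq ?_)
        exact S.slackInterference_eq (fun _ _ => rfl) (fun _ => rfl) d
      | budget m => exact sub_nonneg.2 (hbud m)
      | order m p => exact sub_nonneg.2 (hord m p)
      | nonneg m u => exact hamp m u
      | level d => exact sub_nonneg.2 (h1 d)
      | rate u => exact sub_nonneg.2 (h2 u)
    · change 0 ≤ 0.25 * (p κ u + (p κ u)⁻¹) ^ 2 - (0.25 * (p κ u - (p κ u)⁻¹) ^ 2 + 1)
      have h3 : p κ u * (p κ u)⁻¹ = 1 := mul_inv_cancel₀ (hp κ u).ne'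
      nlinarith
  -- Rates of the users with vanishing level are nonnegative, so dropping them loses nothing.
  -- Optimality of `x (κ + 1)` enters only through its value.
  refine le_trans (mul_le_mul_of_nonneg_left (Finset.sum_le_sum fun u _ => ?_) S.prelog_pos.le)
    (((hrun κ).2 _ hY).trans (h.objective_le hl hrun h₀ (κ + 1)))
  change _ ≤ r κ u
  simp only [r]
  split_ifs with hu
  · exact le_rfl
  · exact Real.logb_nonneg one_lt_two (by linarith [(hx κ).phi_pos u])

end IsLimit
end Network

/-! ### First-order conditions at the limit -/

namespace Network

variable {S : Network}

/-- The constraints that involve the SINR and rate bounds of the users in `A` only. -/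
def Con.Keeps (A : S.UE → Prop) : Con S → Prop
  | .signal d => A d.sig
  | .interf d => A d.sig
  | .level d => A d.sig
  | .rate u => A u
  | _ => True

open Classical in
/-- The gradient of the sum of the rates of the users in `A`. -/
def partialObjective (S : Network) (A : S.UE → Prop) : S.Point →L[ℝ] ℝ :=
  S.prelog • ∑ u, if A u then S.coord (.rate u) else 0

open Classical in
theorem partialObjective_apply (A : S.UE → Prop) (v : S.Point) :
    S.partialObjective A v = S.prelog * ∑ u, if A u then v (.rate u) else 0 := by
  simp only [partialObjective, smul_apply, sum_apply, smul_eq_mul]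
  congr 1
  refine Finset.sum_congr rfl fun u _ => ?_
  split_ifs <;> rfl

open Classical in
/-- The bounds used by the program built at the limit `y`, with `φ̄` eliminated. -/
def limitConstraint (y : S.Point) : Con S → S.Point → ℝ :=
  S.constraint
    (fun d x => S.dof * (2 * y (.varpi d) / (y (.theta d) + 1) * x (.varpi d) -
      y (.varpi d) ^ 2 / (y (.theta d) + 1) ^ 2 * (x (.theta d) + 1)))
    (fun u x => if 0 < y (.phi u) then Real.log (1 + y (.phi u)) + y (.phi u) / (y (.phi u) + 1) -
      y (.phi u) ^ 2 / (y (.phi u) + 1) * (x (.phi u))⁻¹ else Real.log (1 + x (.phi u)))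

theorem limitConstraint_self {y : S.Point} (hy : y ∈ S.slackProblem.dom) (i : Con S) :
    limitConstraint y i y = S.slackProblem.con i y := by
  cases i with
  | level d =>
    have h1 : 0 < y (.theta d) + 1 := by have := hy.2 d; linarith
    simp only [limitConstraint, slackProblem, constraint]
    field_simp
    ring
  | rate u =>
    simp only [limitConstraint, slackProblem, constraint]
    split_ifs with hu
    · field_simp
      ring
    · rfl
  | _ => rfl

/-- Tangency of both minorants at their expansion point: the limiting program and the nonconvex
problem share values and gradients at `y`, so multipliers of one serve the other. -/
theorem hasFDerivAt_limitConstraint {y : S.Point} (hy : y ∈ S.slackProblem.dom) (i : Con S) :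
    HasFDerivAt (limitConstraint y i) (S.slackDeriv y i) y := by
  refine S.hasFDerivAt_constraint (fun d => S.hasFDerivAt_linearization d _ _ y) (fun u => ?_) i
  split_ifs with hu
  · have h1 : HasFDerivAt (fun x : S.Point => (x (.phi u))⁻¹)
        ((-(y (.phi u) ^ 2)⁻¹) • S.coord (.phi u)) y :=
      (hasDerivAt_inv hu.ne').comp_hasFDerivAt y (S.hasFDerivAt_coord (.phi u) y)
    refine ((h1.const_mul _).const_sub _).congr_fderiv ?_
    ext v
    simp only [smul_apply, neg_apply, add_apply, coord_apply, smul_eq_mul, Pi.zero_apply]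
    field_simp
    ring
  · exact S.hasFDerivAt_log_phi u (by have := hy.1 u; linarith)

namespace IsLimit

variable {x : ℕ → S.Point} {l : Filter ℕ} {y : S.Point} [l.NeBot]

/-- At the limit `y` no direction increases the rates of the users with `0 < φ` and all active
constraints that concern them. -/
theorem not_exists_ascent (h : IsLimit x l y) (hl : l ≤ atTop) (hrun : S.IsRun x)
    (h₀ : S.IsFeasiblePoint (x 0)) :
    ¬ ∃ v, 0 < S.partialObjective (fun u => 0 < y (.phi u)) v ∧
      ∀ i : Con S, (S.slackProblem.con i y = 0 ∧ i.Keeps fun u => 0 < y (.phi u)) →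
        0 < S.slackDeriv y i v := by
  classical
  rintro ⟨v, hfv, hgv⟩
  have hx := hrun.isFeasiblePoint h₀
  obtain ⟨hdom, hfeas⟩ := h.feasible hx
  have hline : Tendsto (fun t : ℝ => y + t • v) (𝓝[>] 0) (𝓝 y) := by
    have := (by fun_prop : Continuous fun t : ℝ => y + t • v).tendsto 0
    simp only [zero_smul, add_zero] at this
    exact this.mono_left nhdsWithin_le_nhds
  have hev1 : ∀ᶠ t : ℝ in 𝓝[>] 0, ∀ i : Con S, (i.Keeps fun u => 0 < y (.phi u)) →
      0 < limitConstraint y i (y + t • v) := by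
    refine eventually_all.2 fun i => ?_
    by_cases hi : i.Keeps fun u => 0 < y (.phi u)
    · refine (eventually_pos_of_hasFDerivAt (hasFDerivAt_limitConstraint hdom i) ?_
        fun h0 => ?_).mono fun t ht _ => ht
      · rw [limitConstraint_self hdom]
        exact hfeas i
      · rw [limitConstraint_self hdom] at h0
        exact hgv i ⟨h0, hi⟩
    · exact Eventually.of_forall fun t h => absurd h hi
  have hev2 : ∀ᶠ t : ℝ in 𝓝[>] 0, ∀ u, 0 < y (.phi u) → 0 < (y + t • v) (.phi u) := by
    refine eventually_all.2 fun u => ?_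
    by_cases hu : 0 < y (.phi u)
    · exact (((continuous_apply (Coord.phi u)).continuousAt.tendsto.comp hline).eventually
        (lt_mem_nhds hu)).mono fun t ht _ => ht
    · exact Eventually.of_forall fun t h => absurd h hu
  have hev3 : ∀ᶠ t : ℝ in 𝓝[>] 0, ∀ d, 0 < y (.varpi d) →
      0 < 2 * S.received (y + t • v) d.sig d.rx -
        y (.varpi d) / (y (.theta d) + 1) * (S.ampInterference (y + t • v) d + 1) := by
    refine eventually_all.2 fun d => ?_
    by_cases hd : 0 < y (.varpi d)
    · have hc : Continuous fun w : S.Point => 2 * S.received w d.sig d.rx -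
          y (.varpi d) / (y (.theta d) + 1) * (S.ampInterference w d + 1) :=
        ((continuous_received _ _).const_mul 2).sub
          (((continuous_ampInterference d).add_const 1).const_mul _)
      refine ((hc.continuousAt.tendsto.comp hline).eventually (lt_mem_nhds ?_)).mono
        fun t ht _ => ht
      -- At `y` the received amplitude is at least `ϖ` and the interference at most `θ`, so the
      -- expression is at least `2ϖ - ϖ > 0`; continuity preserves this for small `t`.
      have h1 : y (.varpi d) ≤ S.received y d.sig d.rx := sub_nonneg.1 (hfeas (.signal d))
      have h2 : S.slackInterference y d ≤ y (.theta d) := sub_nonneg.1 (hfeas (.interf d))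
      have h3 := S.ampInterference_le (fun m u => hfeas (.nonneg m u))
        (fun t => sub_nonneg.1 (hfeas (.cross t))) d
      have h4 := h.theta_nonneg hx d
      have h5 : y (.varpi d) / (y (.theta d) + 1) * (S.ampInterference y d + 1) ≤
          y (.varpi d) / (y (.theta d) + 1) * (y (.theta d) + 1) :=
        mul_le_mul_of_nonneg_left (by linarith) (by positivity)
      rw [div_mul_cancel₀ _ (by positivity)] at h5
      linarith
    · exact Eventually.of_forall fun t h => absurd h hd
  obtain ⟨t, hcon, hphi, hint, ht⟩ :=
    (hev1.and (hev2.and (hev3.and self_mem_nhdsWithin))).exists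
  have ht' : (0 : ℝ) < t := ht
  set w := y + t • v with hw
  have hamp : ∀ m u, 0 < w (.amp m u) := fun m u => hcon (.nonneg m u) trivial
  have hcross : ∀ t : S.Triple, S.received w ⟨t.1, t.2.1.2.2⟩ ⟨t.1, t.2.1.2.1⟩ ≤
      w (.tau ⟨t.1, t.2.1.2.1, t.2.1.2.2⟩) :=
    fun t => (sub_pos.1 (hcon (.cross t) trivial)).le
  have hle := h.rate_sum_le (w := w) hl hrun h₀ (fun m u => (hamp m u).le)
    (fun m => (sub_pos.1 (hcon (.budget m) trivial)).le)
    (fun m p => (sub_pos.1 (hcon (.order m p) trivial)).le) hphi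
    (fun d hd => ?_) (fun d hd => ?_) (fun u hu => ?_)
  · have h1 : S.partialObjective (fun u => 0 < y (.phi u)) w =
        S.partialObjective (fun u => 0 < y (.phi u)) y +
          t * S.partialObjective (fun u => 0 < y (.phi u)) v := by
      rw [hw, map_add, map_smul, smul_eq_mul]
    rw [partialObjective_apply, partialObjective_apply] at h1
    have h2 : ∑ u, (if 0 < y (.phi u) then y (.rate u) else 0) =
        ∑ u, Real.logb 2 (1 + y (.phi u)) := by
      refine Finset.sum_congr rfl fun u _ => ?_
      split_ifs with hu
      · exact h.rate u
      · rw [le_antisymm (not_lt.1 hu) (h.phi_nonneg hx u), add_zero, Real.logb_one]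
    rw [h2] at h1
    have := mul_pos ht' hfv
    linarith
  · have h1 : w (.phi d.sig) < S.dof * (2 * y (.varpi d) / (y (.theta d) + 1) * w (.varpi d) -
        y (.varpi d) ^ 2 / (y (.theta d) + 1) ^ 2 * (w (.theta d) + 1)) :=
      sub_pos.1 (hcon (.level d) hd)
    have h2 : w (.varpi d) ≤ S.received w d.sig d.rx := (sub_pos.1 (hcon (.signal d) hd)).le
    have h3 : S.slackInterference w d ≤ w (.theta d) := (sub_pos.1 (hcon (.interf d) hd)).le
    have h4 := S.ampInterference_le (fun m u => (hamp m u).le) hcross d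
    have h5 := h.theta_nonneg hx d
    have h6 := h.varpi_nonneg hx d
    refine h1.trans_le (mul_le_mul_of_nonneg_left (sub_le_sub ?_ ?_) S.dof_pos.le)
    · exact mul_le_mul_of_nonneg_left h2 (by positivity)
    · exact mul_le_mul_of_nonneg_left (by linarith) (by positivity)
  · rcases (h.varpi_nonneg hx d).eq_or_lt with h1 | h1
    · rw [← h1, zero_div, zero_mul, sub_zero]
      -- With `ϖ = 0` at the limit only a positive received amplitude is needed. All amplitudes of
      -- `w` are positive, and an access point exists because `ϖ > 0` at the initial point.
      obtain ⟨m⟩ : Nonempty (Fin S.M) := by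
        by_contra hM
        rw [not_nonempty_iff] at hM
        have := ((hx 0).varpi_pos d).trans_le ((hx 0).varpi_le d)
        simp [received] at this
      have : 0 < S.received w d.sig d.rx := Finset.sum_pos
        (fun m _ => mul_pos (hamp m _) (Real.sqrt_pos.2 (S.γ_pos m _))) ⟨m, Finset.mem_univ m⟩
      linarith
    · exact hint d h1
  · have h1 := sub_pos.1 (hcon (.rate u) hu)
    dsimp only at h1
    rwa [if_pos hu] at h1

/-- The limit `y` is a KKT point if every user with `φ = 0` has a vanishing `ϖ`. -/
theorem isKKT (h : IsLimit x l y) (hl : l ≤ atTop) (hrun : S.IsRun x)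
    (h₀ : S.IsFeasiblePoint (x 0))
    (hy : ∀ u, 0 < y (.phi u) ∨ ∃ d : S.DecPair, d.sig = u ∧ y (.varpi d) = 0) :
    S.slackProblem.IsKKT y := by
  classical
  have hx := hrun.isFeasiblePoint h₀
  have hfeas := h.feasible hx
  obtain ⟨v, hv, -⟩ := exists_constraint_direction
    (fun d x => S.dof * (x (.varpi d) ^ 2 / (x (.theta d) + 1)))
    (fun u x => Real.log (1 + x (.phi u)))
    (fun d => S.dof * (2 * y (.varpi d) / (y (.theta d) + 1)))
    (fun d => -(S.dof * (y (.varpi d) ^ 2 / (y (.theta d) + 1) ^ 2)))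
    (fun u => (1 + y (.phi u))⁻¹) 0 y
  obtain ⟨mult, hm0, hmJ, hmsum⟩ := exists_multipliers
    (fun i : Con S => S.slackProblem.con i y = 0 ∧ i.Keeps fun u => 0 < y (.phi u))
    (S.partialObjective fun u => 0 < y (.phi u)) (S.slackDeriv y)
    (h.not_exists_ascent hl hrun h₀) ⟨v, fun i hi => hv i hi.1⟩
  have hd : ∀ u, ∃ d : S.DecPair, d.sig = u ∧ (¬ 0 < y (.phi u) → y (.varpi d) = 0) := fun u => by
    rcases hy u with hu | ⟨d, hd, hd0⟩
    · exact ⟨⟨u.1, (u.2, u.2), le_rfl⟩, rfl, fun hn => absurd hu hn⟩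
    · exact ⟨d, hd, fun _ => hd0⟩
  choose d hdsig hdvarpi using hd
  have hphi0 : ∀ u, ¬ 0 < y (.phi u) → y (.phi u) = 0 := fun u hu =>
    le_antisymm (not_lt.1 hu) (h.phi_nonneg hx u)
  have hlog := Real.log_pos one_lt_two
  let k : ℝ := S.prelog / Real.log 2
  have hk : 0 ≤ k := div_nonneg S.prelog_pos.le hlog.le
  -- For `φ = 0` and `ϖ = 0` the rate gradient is `dφ - log 2 dr` and the level gradient is `-dφ`.
  -- Weighting both by `k = prelog / log 2` produces `-prelog dr`, which cancels the part of the
  -- objective gradient missing from `partialObjective`.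
  let extra : S.UE → Con S → ℝ := fun u i => if 0 < y (.phi u) then 0 else
    k * ((if i = .rate u then 1 else 0) + if i = .level (d u) then 1 else 0)
  have hextra0 : ∀ u i, 0 ≤ extra u i := fun u i => by
    simp only [extra]
    split_ifs <;> simp [hk]
  refine ⟨hfeas, fun i => mult i + ∑ u, extra u i, S.objectiveDeriv, S.slackDeriv y,
    fun i => add_nonneg (hm0 i) (Finset.sum_nonneg fun u _ => hextra0 u i), fun i => ?_,
    S.hasFDerivAt_objective y, hasFDerivAt_slackProblem_con hfeas.1, ?_⟩
  · have h1 : mult i * S.slackProblem.con i y = 0 := by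
      by_cases hi : S.slackProblem.con i y = 0
      · rw [hi, mul_zero]
      · rw [hmJ i fun hJ => hi hJ.1, zero_mul]
    rw [add_mul, h1, zero_add, Finset.sum_mul]
    refine Finset.sum_eq_zero fun u _ => ?_
    by_cases hu : 0 < y (.phi u)
    · simp only [extra, if_pos hu, zero_mul]
    · have h2 : S.slackProblem.con (.rate u) y = 0 := by
        change Real.log (1 + y (.phi u)) - y (.rate u) * Real.log 2 = 0
        rw [h.rate u, logb_two_mul_log_two, sub_self]
      have h3 : S.slackProblem.con (.level (d u)) y = 0 := by
        change S.dof * (y (.varpi (d u)) ^ 2 / (y (.theta (d u)) + 1)) - y (.phi (d u).sig) = 0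
        rw [hdsig, hdvarpi u hu, hphi0 u hu]
        simp
      simp only [extra, if_neg hu]
      by_cases hi1 : i = .rate u
      · rw [hi1, h2, mul_zero]
      · by_cases hi2 : i = .level (d u)
        · rw [hi2, h3, mul_zero]
        · simp [hi1, hi2]
  · ext v
    have h1 : S.partialObjective (fun u => 0 < y (.phi u)) v + ∑ i, mult i * S.slackDeriv y i v =
        0 := by
      have := congrArg (fun L : S.Point →L[ℝ] ℝ => L v) hmsum
      simpa only [add_apply, sum_apply, smul_apply, smul_eq_mul, zero_apply] using this
    have h2 : ∀ u, ∑ i, extra u i * S.slackDeriv y i v =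
        if 0 < y (.phi u) then 0 else -(S.prelog * v (.rate u)) := by
      intro u
      simp only [extra]
      split_ifs with hu
      · simp
      · have h3 : ∀ i : Con S, k * ((if i = .rate u then (1 : ℝ) else 0) +
            if i = .level (d u) then 1 else 0) * S.slackDeriv y i v =
            (if i = .rate u then k * S.slackDeriv y i v else 0) +
              if i = .level (d u) then k * S.slackDeriv y i v else 0 := fun i => by
          split_ifs <;> ring
        simp only [h3, Finset.sum_add_distrib, Finset.sum_ite_eq', Finset.mem_univ, if_true]
        simp only [slackDeriv, constraintDeriv, sub_apply, add_apply, smul_apply, coord_apply,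
          smul_eq_mul, hdsig, hdvarpi u hu, hphi0 u hu, k, Pi.zero_apply]
        field_simp
        ring
    simp only [add_apply, sum_apply, smul_apply, smul_eq_mul, zero_apply, objectiveDeriv_apply,
      add_mul, Finset.sum_add_distrib, Finset.sum_mul]
    rw [Finset.sum_comm, Finset.sum_congr rfl fun u _ => h2 u]
    rw [partialObjective_apply, Finset.mul_sum] at h1
    rw [objective, Finset.mul_sum]
    have h4 : ∑ u, S.prelog * v (.rate u) =
        ∑ u, (S.prelog * if 0 < y (.phi u) then v (.rate u) else 0) -
          ∑ u, if 0 < y (.phi u) then 0 else -(S.prelog * v (.rate u)) := by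
      rw [← Finset.sum_sub_distrib]
      refine Finset.sum_congr rfl fun u _ => ?_
      split_ifs <;> ring
    linarith

end IsLimit
end Network

namespace Network

variable {S : Network}

/-! ### Accumulation points of runs -/

/-- The amplitudes are not part of the iterate, but the budgets keep them in compact intervals, so
they converge along any ultrafilter; the other coordinates of the normalized points depend
continuously on the amplitudes and the iterate. -/
theorem exists_isLimit {x : ℕ → S.Point} (hx : ∀ κ, S.IsFeasiblePoint (x κ)) {U : Ultrafilter ℕ}
    {z : S.Iterate} (hz : Tendsto (fun κ => S.iterate (x κ)) U (𝓝 z)) :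
    ∃ y, IsLimit x U y ∧ S.iterate y = z := by
  have hamp : ∀ m u, ∃ a, Tendsto (fun κ => x κ (.amp m u)) U (𝓝 a) := fun m u => by
    have hmem : ∀ κ, x κ (.amp m u) ∈ Set.Icc 0 √(S.Pmax m) := fun κ =>
      ⟨(hx κ).amp_nonneg m u, S.amp_le ((hx κ).budget m) u⟩
    obtain ⟨a, -, ha⟩ := isCompact_Icc.ultrafilter_le_nhds (U.map fun κ => x κ (.amp m u))
      (le_principal_iff.2 (Ultrafilter.mem_map.2 (univ_mem' hmem)))
    exact ⟨a, ha⟩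
  choose a ha using hamp
  have hphi : ∀ u, Tendsto (fun κ => x κ (.phi u)) U (𝓝 (z.1 u)) := fun u =>
    ((continuous_apply u).comp continuous_fst).continuousAt.tendsto.comp hz
  have hvarpi : ∀ d, Tendsto (fun κ => x κ (.varpi d)) U (𝓝 (z.2.1 d)) := fun d =>
    ((continuous_apply d).comp (continuous_fst.comp continuous_snd)).continuousAt.tendsto.comp hz
  have htheta : ∀ d, Tendsto (fun κ => x κ (.theta d)) U (𝓝 (z.2.2 d)) := fun d =>
    ((continuous_apply d).comp (continuous_snd.comp continuous_snd)).continuousAt.tendsto.comp hz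
  refine ⟨S.tight 0 (S.ofParts a 0 z.1 0 z.2.1 0 z.2.2), ⟨tendsto_pi_nhds.2 fun c => ?_,
    fun u => rfl⟩, rfl⟩
  cases c with
  | amp m u => exact ha m u
  | rate u =>
    have h1 : 0 ≤ z.1 u := ge_of_tendsto' (hphi u) fun κ => ((hx κ).phi_pos u).le
    exact ((hphi u).const_add 1).logb (by linarith)
  | phi u => exact hphi u
  | phibar u => exact tendsto_const_nhds
  | varpi d => exact hvarpi d
  | tau c =>
    exact tendsto_finsetSum Finset.univ fun m _ =>
      (ha m ⟨c.1, c.2.2⟩).mul_const √(S.γ m ⟨c.1, c.2.1⟩)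
  | theta d => exact htheta d

namespace IsRun

variable {x : ℕ → S.Point}

theorem isKKTIterate_of_mapClusterPt (hx : S.IsRun x) (h₀ : S.IsFeasiblePoint (x 0))
    {z : S.Iterate} (hz : MapClusterPt z atTop fun κ => S.iterate (x κ))
    (hprov : ∀ u, 0 < z.1 u ∨ ∃ d : S.DecPair, d.sig = u ∧ z.2.1 d = 0) : S.IsKKTIterate z := by
  obtain ⟨U, hU, hlim⟩ := mapClusterPt_iff_ultrafilter.1 hz
  obtain ⟨y, hy, rfl⟩ := exists_isLimit (hx.isFeasiblePoint h₀) hlim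
  exact ⟨y, rfl, hy.isKKT hU hx h₀ hprov⟩

/-- At an optimal solution of the program, one of the SINR constraints of each user is tight. -/
theorem _root_.Network.exists_level_le_of_isOptimal {z : S.Iterate} {y : S.Point}
    (hy : (S.cqp z).IsOptimal y) {u : S.UE} (hu : 0 < z.1 u) :
    ∃ d : S.DecPair, d.sig = u ∧ S.dof * (2 * z.2.1 d / (z.2.2 d + 1) * y (.varpi d) -
      z.2.1 d ^ 2 / (z.2.2 d + 1) ^ 2 * (y (.theta d) + 1)) ≤ y (.phi u) := by
  classical
  by_contra hcon
  push Not at hcon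
  have hphi : ∀ u, 0 < y (.phi u) := hy.1.1
  have hev : ∀ᶠ p in 𝓝[>] (y (.phi u)), ∀ d : S.DecPair, d.sig = u →
      p < S.dof * (2 * z.2.1 d / (z.2.2 d + 1) * y (.varpi d) -
        z.2.1 d ^ 2 / (z.2.2 d + 1) ^ 2 * (y (.theta d) + 1)) := by
    refine eventually_all.2 fun d => ?_
    by_cases hd : d.sig = u
    · exact ((gt_mem_nhds (hcon d hd)).filter_mono nhdsWithin_le_nhds).mono fun p hp _ => hp
    · exact Eventually.of_forall fun p h => absurd h hd
  -- If every level constraint of `u` were slack, raising `φ` to `p` and lowering `φ̄` to `p⁻¹`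
  -- would allow a strictly larger rate for `u`, all else unchanged.
  obtain ⟨p, hp, hup⟩ := (hev.and self_mem_nhdsWithin).exists
  have hup' : y (.phi u) < p := hup
  have hp0 : 0 < p := (hphi u).trans hup'
  let b : ℝ → ℝ := fun t => Real.log (1 + z.1 u) + z.1 u / (z.1 u + 1) -
    z.1 u ^ 2 / (z.1 u + 1) * t
  let y' : S.Point := S.ofParts (fun m u => y (.amp m u))
    (Function.update (fun u => y (.rate u)) u (b p⁻¹ / Real.log 2))
    (Function.update (fun u => y (.phi u)) u p) (Function.update (fun u => y (.phibar u)) u p⁻¹)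
    (fun d => y (.varpi d)) (fun c => y (.tau c)) (fun d => y (.theta d))
  have hfeas : (S.cqp z).Feasible y' := by
    refine ⟨fun v => ?_, ?_⟩
    · change 0 < Function.update (fun u => y (.phi u)) u p v
      by_cases hv : v = u
      · rw [hv, Function.update_self]; exact hp0
      · rw [Function.update_of_ne hv]; exact hphi v
    rintro (i | v)
    · cases i with
      | level d =>
        refine sub_nonneg.2 ?_
        change Function.update (fun u => y (.phi u)) u p d.sig ≤ _
        by_cases hd : d.sig = u
        · rw [hd, Function.update_self]; exact (hp d hd).le
        · rw [Function.update_of_ne hd]; exact cqp_level_le hy.1 d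
      | rate v =>
        refine sub_nonneg.2 ?_
        change Function.update (fun u => y (.rate u)) u (b p⁻¹ / Real.log 2) v * _ ≤
          Real.log (1 + z.1 v) + z.1 v / (z.1 v + 1) - z.1 v ^ 2 / (z.1 v + 1) *
            Function.update (fun u => y (.phibar u)) u p⁻¹ v
        by_cases hv : v = u
        · rw [hv, Function.update_self, Function.update_self,
            div_mul_cancel₀ _ (Real.log_pos one_lt_two).ne']
        · rw [Function.update_of_ne hv, Function.update_of_ne hv]; exact cqp_rate_le hy.1 v
      | signal d => exact hy.1.2 (.inl (.signal d))
      | cross t => exact hy.1.2 (.inl (.cross t))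
      | interf d => exact hy.1.2 (.inl (.interf d))
      | budget m => exact hy.1.2 (.inl (.budget m))
      | order m p => exact hy.1.2 (.inl (.order m p))
      | nonneg m u => exact hy.1.2 (.inl (.nonneg m u))
    · change 0 ≤ 0.25 * (Function.update (fun u => y (.phi u)) u p v +
          Function.update (fun u => y (.phibar u)) u p⁻¹ v) ^ 2 -
        (0.25 * (Function.update (fun u => y (.phi u)) u p v -
          Function.update (fun u => y (.phibar u)) u p⁻¹ v) ^ 2 + 1)
      by_cases hv : v = u
      · rw [hv, Function.update_self, Function.update_self]
        have h1 : p * p⁻¹ = 1 := mul_inv_cancel₀ hp0.ne'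
        nlinarith
      · rw [Function.update_of_ne hv, Function.update_of_ne hv]; exact hy.1.2 (.inr v)
  have hrate : y (.rate u) < b p⁻¹ / Real.log 2 := by
    rw [lt_div_iff₀ (Real.log_pos one_lt_two)]
    refine (cqp_rate_le hy.1 u).trans_lt (sub_lt_sub_left ?_ _)
    refine mul_lt_mul_of_pos_left ?_ (by positivity)
    rw [inv_lt_iff_one_lt_mul₀ hp0]
    refine (cqp_one_le hy.1 u).trans_lt ?_
    have := cqp_phibar_pos hy.1 u
    nlinarith
  have hlt : S.objective y < S.objective y' := by
    refine mul_lt_mul_of_pos_left (Finset.sum_lt_sum (fun v _ => ?_) ⟨u, Finset.mem_univ u, ?_⟩)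
      S.prelog_pos
    · change _ ≤ Function.update (fun u => y (.rate u)) u (b p⁻¹ / Real.log 2) v
      by_cases hv : v = u
      · rw [hv, Function.update_self]; exact hrate.le
      · rw [Function.update_of_ne hv]
    · change _ < Function.update (fun u => y (.rate u)) u (b p⁻¹ / Real.log 2) u
      rw [Function.update_self]; exact hrate
  exact absurd (hy.2 y' hfeas) (not_le.2 hlt)

/-- If the proviso failed for `u`, consecutive iterates would share the limit, so the linearizations
would tend to `dof * ϖ² / (θ + 1) > 0` while `φ → 0`. Eventually all level constraints of `u` would
be slack, against optimality. -/
theorem isKKTIterate_of_tendsto (hx : S.IsRun x) (h₀ : S.IsFeasiblePoint (x 0))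
    {z : S.Iterate} (hz : Tendsto (fun κ => S.iterate (x κ)) atTop (𝓝 z)) : S.IsKKTIterate z := by
  have hfeas := hx.isFeasiblePoint h₀
  refine hx.isKKTIterate_of_mapClusterPt h₀ hz.mapClusterPt fun u => ?_
  by_contra! hcon
  obtain ⟨hu, hd⟩ := hcon
  have hphi : Tendsto (fun κ => x κ (.phi u)) atTop (𝓝 (z.1 u)) :=
    ((continuous_apply u).comp continuous_fst).continuousAt.tendsto.comp hz
  have hvarpi : ∀ d, Tendsto (fun κ => x κ (.varpi d)) atTop (𝓝 (z.2.1 d)) := fun d =>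
    ((continuous_apply d).comp (continuous_fst.comp continuous_snd)).continuousAt.tendsto.comp hz
  have htheta : ∀ d, Tendsto (fun κ => x κ (.theta d)) atTop (𝓝 (z.2.2 d)) := fun d =>
    ((continuous_apply d).comp (continuous_snd.comp continuous_snd)).continuousAt.tendsto.comp hz
  have hev : ∀ᶠ κ in atTop, ∀ d : S.DecPair, d.sig = u → x (κ + 1) (.phi u) <
      S.dof * (2 * x κ (.varpi d) / (x κ (.theta d) + 1) * x (κ + 1) (.varpi d) -
        x κ (.varpi d) ^ 2 / (x κ (.theta d) + 1) ^ 2 * (x (κ + 1) (.theta d) + 1)) := by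
    refine eventually_all.2 fun d => ?_
    by_cases hdu : d.sig = u
    · have h1 : 0 ≤ z.2.2 d := ge_of_tendsto' (htheta d) fun κ => (hfeas κ).theta_nonneg d
      have h2 : 0 < z.2.1 d := lt_of_le_of_ne
        (ge_of_tendsto' (hvarpi d) fun κ => ((hfeas κ).varpi_pos d).le) (hd d hdu).symm
      have h3 := (htheta d).add_const 1
      have h4 := (((((hvarpi d).const_mul 2).div h3 (by positivity)).mul
        ((tendsto_add_atTop_iff_nat 1).2 (hvarpi d))).sub
        ((((hvarpi d).pow 2).div (h3.pow 2) (by positivity)).mul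
          ((tendsto_add_atTop_iff_nat 1).2 h3))).const_mul S.dof
      refine (((tendsto_add_atTop_iff_nat 1).2 hphi).eventually_lt h4 ?_).mono fun κ hκ _ => hκ
      have h5 : 2 * z.2.1 d / (z.2.2 d + 1) * z.2.1 d -
          z.2.1 d ^ 2 / (z.2.2 d + 1) ^ 2 * (z.2.2 d + 1) = z.2.1 d ^ 2 / (z.2.2 d + 1) := by
        field_simp
        ring
      rw [h5]
      have := S.dof_pos
      exact hu.trans_lt (by positivity)
    · exact Eventually.of_forall fun κ h => absurd h hdu
  obtain ⟨κ, hκ⟩ := hev.exists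
  obtain ⟨d, hdu, hle⟩ := exists_level_le_of_isOptimal (hx κ) (u := u) ((hfeas κ).phi_pos u)
  exact absurd hle (not_le.2 (hκ d hdu))

/-- The iterates with `c ≤ φ` stay in a compact set. -/
theorem exists_mapClusterPt (hx : S.IsRun x) (h₀ : S.IsFeasiblePoint (x 0)) {c : ℝ} (hc : 0 < c)
    (hfreq : ∃ᶠ κ in atTop, ∀ u, c ≤ x κ (.phi u)) :
    ∃ z : S.Iterate, MapClusterPt z atTop (fun κ => S.iterate (x κ)) ∧ ∀ u, c ≤ z.1 u := by
  have hfeas := hx.isFeasiblePoint h₀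
  let K : Set S.Iterate :=
    Set.Icc (fun _ => c) (fun u => S.dof * S.receivedBound u ^ 2) ×ˢ
      (Set.Icc 0 (fun d => S.receivedBound d.rx) ×ˢ
        Set.Icc 0 (fun d => S.dof * S.receivedBound d.rx ^ 2 / c))
  have hK : IsCompact K := isCompact_Icc.prod (isCompact_Icc.prod isCompact_Icc)
  obtain ⟨z, hzK, hz⟩ := hK.exists_mapClusterPt_of_frequently
    (l := atTop) (f := fun κ => S.iterate (x κ)) (hfreq.mono fun κ hκ => by
      refine ⟨⟨hκ, fun u => (hfeas κ).phi_le_bound u⟩,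
        ⟨fun d => ((hfeas κ).varpi_pos d).le, fun d => (hfeas κ).varpi_le_bound d⟩,
        fun d => (hfeas κ).theta_nonneg d, fun d => ?_⟩
      change x κ (.theta d) ≤ S.dof * S.receivedBound d.rx ^ 2 / c
      -- Since `θ` has no a priori bound, the level constraint with `φ ≥ c` provides one: `c (θ + 1)
      -- ≤ dof * ϖ²`.
      have h1 := (hκ d.sig).trans ((hfeas κ).phi_le d)
      have h2 := (hfeas κ).theta_nonneg d
      have h3 := pow_le_pow_left₀ ((hfeas κ).varpi_pos d).le ((hfeas κ).varpi_le_bound d) 2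
      have h4 := mul_le_mul_of_nonneg_left h3 S.dof_pos.le
      rw [← mul_div_assoc, le_div_iff₀ (by linarith)] at h1
      rw [le_div_iff₀ hc]
      nlinarith)
  exact ⟨z, hz, hzK.1.1⟩

end IsRun
end Network

end

theorem proposition1 (S : Network) :
    -- every step is possible, whatever the solver returned before, and keeps feasibility
    (∀ x : S.Point, S.IsFeasiblePoint x →
      (∃ y, (S.cqp (S.iterate x)).IsOptimal y) ∧
      ∀ y, (S.cqp (S.iterate x)).IsOptimal y → S.IsFeasiblePoint y) ∧
    -- the algorithm can be run from every feasible point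
    (∀ x₀ : S.Point, S.IsFeasiblePoint x₀ → ∃ x : ℕ → S.Point, x 0 = x₀ ∧ S.IsRun x) ∧
    -- every run
    ∀ x : ℕ → S.Point, S.IsFeasiblePoint (x 0) → S.IsRun x →
      -- feasible for the nonconvex problem and for the original problem
      (∀ κ, S.IsFeasiblePoint (x κ) ∧
        S.SumSEFeasible (S.powers (x κ)) (fun u => x κ (.rate u)) (fun u => x κ (.phi u))) ∧
      -- each solution improves on the point at which its program was built
      (∀ κ, S.prelog * ∑ u, Real.logb 2 (1 + x κ (.phi u)) ≤ S.objective (x (κ + 1))) ∧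
      -- the objective values increase monotonically and converge
      Monotone (fun κ => S.objective (x κ)) ∧
      (∃ R : ℝ, Tendsto (fun κ => S.objective (x κ)) atTop (𝓝 R)) ∧
      -- the stopping rule is met after finitely many iterations
      (∀ ε : ℝ, 0 < ε → ∃ κ₀, ∀ κ, κ₀ ≤ κ → S.Stops ε (x (κ + 1)) (x (κ + 2))) ∧
      -- each solution satisfies the KKT conditions of its conic quadratic program
      (∀ κ, (S.cqp (S.iterate (x κ))).IsKKT (x (κ + 1))) ∧
      -- accumulation points of the iterates are KKT points of the nonconvex problem
      (∀ z : S.Iterate, MapClusterPt z atTop (fun κ => S.iterate (x κ)) →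
        (∀ u, 0 < z.1 u ∨ ∃ d : S.DecPair, d.sig = u ∧ z.2.1 d = 0) → S.IsKKTIterate z) ∧
      -- if the iterates converge, their limit is a KKT point, without any proviso
      (∀ z : S.Iterate, Tendsto (fun κ => S.iterate (x κ)) atTop (𝓝 z) → S.IsKKTIterate z) ∧
      -- there are accumulation points, with positive `φ`, unless `min φ` tends to `0`
      (∀ c : ℝ, 0 < c → (∃ᶠ κ in atTop, ∀ u, c ≤ x κ (.phi u)) →
        ∃ z : S.Iterate, MapClusterPt z atTop (fun κ => S.iterate (x κ)) ∧ ∀ u, c ≤ z.1 u) := by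
  exact ⟨fun x hx => ⟨hx.exists_isOptimal, fun y hy => hx.of_cqp hy.1⟩,
    fun x₀ h₀ => h₀.exists_isRun, fun x h₀ hx =>
    ⟨fun κ => ⟨hx.isFeasiblePoint h₀ κ, (hx.isFeasiblePoint h₀ κ).sumSEFeasible⟩,
      hx.logb_le h₀, hx.monotone h₀, hx.exists_tendsto h₀, fun _ hε => hx.exists_stops h₀ hε,
      fun κ => Network.isKKT_of_isOptimal_cqp (hx κ),
      fun _ hz hprov => hx.isKKTIterate_of_mapClusterPt h₀ hz hprov,
      fun _ hz => hx.isKKTIterate_of_tendsto h₀ hz,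
      fun _ hc hfreq => hx.exists_mapClusterPt h₀ hc hfreq⟩⟩
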